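/- Let $(\Omega,\mathcal F,P)$ be a probability space, $\mathbb K\in\{\mathbb R,\mathbb C\}$, and let $L^0(\mathcal F,\mathbb K)$ be the algebra of $\mathbb K$-valued random variables modulo a.s. equality; $L^0_+(\mathcal F)$ denotes the set of classes of nonnegative real random variables, and $I_A\in L^0(\mathcal F,\mathbb K)$ the class of the indicator function of $A\in\mathcal F$. A random normed module is an $L^0(\mathcal F,\mathbb K)$-module $E$ with a map $\|\cdot\|:E\to L^0_+(\mathcal F)$ such that $\|\xi x\|=|\xi|\,\|x\|$, $\|x+y\|\le\|x\|+\|y\|$, and $\|x\|=0$ implies $x=0$. A sequence $x_k$ in $E$ converges to $x$ in the $(\varepsilon,\lambda)$-topology if for all $\varepsilon>0$ and $0<\lambda<1$ one has $P(\|x_k-x\|<\varepsilon)>1-\lambda$ for all large $k$ (i.e. $\|x_k-x\|\to0$ in probability). For a sequence $(y_l)$ in $E$ and a countable measurable partition $(A_l)$ of $\Omega$, $\sum_l I_{A_l}y_l$ denotes the (unique, if it exists) $y\in E$ with $I_{A_l}y=I_{A_l}y_l$ for all $l$. **Lemma.** Let $n\ge1$ and let $x_1,\dots,x_n\in E$ be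 $L^0$-affinely independent, i.e. the differences $x_i-x_1$ $(2\le i\le n)$ are linearly independent over $L^0(\mathcal F,\mathbb K)$ (no condition if $n=1$). Let $$S=\Big\{\sum_{i=1}^n\xi_ix_i:\ \xi_i\in L^0_+(\mathcal F),\ \sum_{i=1}^n\xi_i=1\Big\}$$ be the $(n-1)$-dimensional $L^0$-simplex with vertices $x_1,\dots,x_n$. Let $f:S\to S$ be * $\sigma$-stable: $f\big(\sum_l I_{A_l}y_l\big)=\sum_l I_{A_l}f(y_l)$ for every sequence $(y_l)$ in $S$ and every countable measurable partition $(A_l)$ of $\Omega$; * random sequentially continuous: whenever a sequence $(y_k)$ in $S$ converges in the $(\varepsilon,\lambda)$-topology to some $y\in S$, there are $\mathbb N$-valued random variables $\nu_k$ (up to a.s. equality) with $\nu_k<\nu_{k+1}$ a.s. for all $k$ such that the random subsequence $y_{\nu_k}:=\sum_l I_{\{\nu_k=l\}}y_l\in S$ satisfies $f(y_{\nu_k})\to f(y)$ in the $(\varepsilon,\lambda)$-topology. Then $f$ has a fixed point, i.e. there is $z\in S$ with $f(z)=z$. -/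

import Mathlib

open MeasureTheory Filter

noncomputable section

namespace RandomBrouwer

/-- `L⁰(𝓕, R)`, the equivalence classes of random variables modulo almost sure equality, is a
commutative ring under the pointwise operations, which are those of Mathlib. -/
instance instCommRingL0 {Ω : Type*} [MeasurableSpace Ω] {P : Measure Ω} {R : Type*}
    [NormedCommRing R] : CommRing (Ω →ₘ[P] R) :=
  { AEEqFun.instAddCommGroup, (AEEqFun.instCommMonoid : CommMonoid (Ω →ₘ[P] R)) with
    left_distrib := fun f g h => by
      refine AEEqFun.induction_on₃ f g h fun f hf g hg h hh => ?_
      simp only [AEEqFun.mk_add_mk, AEEqFun.mk_mul_mk, mul_add]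
    right_distrib := fun f g h => by
      refine AEEqFun.induction_on₃ f g h fun f hf g hg h hh => ?_
      simp only [AEEqFun.mk_add_mk, AEEqFun.mk_mul_mk, add_mul]
    zero_mul := fun f => by
      refine AEEqFun.induction_on f fun f hf => ?_
      rw [AEEqFun.zero_def, AEEqFun.mk_mul_mk]
      exact AEEqFun.mk_eq_mk.2 (Eventually.of_forall fun ω => by simp)
    mul_zero := fun f => by
      refine AEEqFun.induction_on f fun f hf => ?_
      rw [AEEqFun.zero_def, AEEqFun.mk_mul_mk]
      exact AEEqFun.mk_eq_mk.2 (Eventually.of_forall fun ω => by simp) }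

section L0

variable {Ω : Type*} [MeasurableSpace Ω] {P : Measure Ω}

/-- The class `|ξ|` of `ω ↦ |ξ(ω)|`, for `ξ ∈ L⁰(𝓕, 𝕂)`. -/
def absL0 {𝕂 : Type*} [RCLike 𝕂] (ξ : Ω →ₘ[P] 𝕂) : Ω →ₘ[P] ℝ :=
  AEEqFun.comp (fun z : 𝕂 => ‖z‖) continuous_norm ξ

/-- The inclusion `L⁰(𝓕, ℝ) ⊆ L⁰(𝓕, 𝕂)`. -/
def ofRealL0 (𝕂 : Type*) [RCLike 𝕂] (ξ : Ω →ₘ[P] ℝ) : Ω →ₘ[P] 𝕂 :=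
  AEEqFun.comp (fun t : ℝ => (t : 𝕂)) RCLike.continuous_ofReal ξ

/-- The class of the characteristic function of a measurable set `A`, as an element of
`L⁰(𝓕, 𝕂)`. -/
def indL0 (P : Measure Ω) (𝕂 : Type*) [RCLike 𝕂] (A : Set Ω) (hA : MeasurableSet A) :
    Ω →ₘ[P] 𝕂 :=
  AEEqFun.mk (A.indicator fun _ => (1 : 𝕂))
    (stronglyMeasurable_const.indicator hA).aestronglyMeasurable

/-- A countable measurable partition of `Ω` (pieces may be empty). -/
structure CountablePartition (Ω : Type*) [MeasurableSpace Ω] where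
  piece : ℕ → Set Ω
  measurableSet_piece : ∀ l, MeasurableSet (piece l)
  disjoint_piece : ∀ i j, i ≠ j → Disjoint (piece i) (piece j)
  iUnion_piece : ⋃ l, piece l = Set.univ

/-- The partition of `Ω` into the events `(ν = l)`, `l ∈ ℕ`, for `ν ∈ L⁰(𝓕, ℕ)`. -/
def levelPartition (ν : Ω →ₘ[P] ℕ) : CountablePartition Ω where
  piece l := {ω | ν ω = l}
  measurableSet_piece l := ν.stronglyMeasurable.measurable (measurableSet_singleton l)
  disjoint_piece i j hij := Set.disjoint_left.2 fun ω (hi : ν ω = i) (hj : ν ω = j) =>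
    hij (hi.symm.trans hj)
  iUnion_piece := Set.eq_univ_of_forall fun ω => Set.mem_iUnion.2 ⟨ν ω, rfl⟩

end L0

/-- A random normed module over `𝕂` with base `(Ω, 𝓕, P)`: a module `E` over `L⁰(𝓕, 𝕂)` with an
`L⁰`-norm `E → L⁰₊(𝓕)`. -/
class RNModule {Ω : Type*} [MeasurableSpace Ω] (P : Measure Ω) (𝕂 : Type*) [RCLike 𝕂]
    (E : Type*) [AddCommGroup E] [Module (Ω →ₘ[P] 𝕂) E] where
  /-- the `L⁰`-norm -/
  rnorm : E → (Ω →ₘ[P] ℝ)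
  rnorm_nonneg : ∀ x, 0 ≤ rnorm x
  rnorm_smul : ∀ (ξ : Ω →ₘ[P] 𝕂) (x : E), rnorm (ξ • x) = absL0 ξ * rnorm x
  rnorm_add_le : ∀ x y, rnorm (x + y) ≤ rnorm x + rnorm y
  eq_zero_of_rnorm : ∀ x, rnorm x = 0 → x = 0

section Module

variable {Ω : Type*} [MeasurableSpace Ω] (P : Measure Ω) (𝕂 : Type*) [RCLike 𝕂]
  {E : Type*} [AddCommGroup E] [Module (Ω →ₘ[P] 𝕂) E]

/-- The `L⁰`-convex hull of `G`: all finite sums `∑ ξᵢ zᵢ` with `zᵢ ∈ G`, `ξᵢ ∈ L⁰₊(𝓕)` and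
`∑ ξᵢ = 1`. -/
def convL0 (G : Set E) : Set E :=
  {y | ∃ (m : ℕ) (z : Fin m → E) (ξ : Fin m → (Ω →ₘ[P] ℝ)),
    (∀ i, z i ∈ G) ∧ (∀ i, 0 ≤ ξ i) ∧ ∑ i, ξ i = 1 ∧ y = ∑ i, ofRealL0 𝕂 (ξ i) • z i}

/-- `L⁰`-affine independence of `x 0, …, x (n - 1)`: the differences `x i - x 0`, `i ≠ 0`, are
linearly independent over `L⁰(𝓕, 𝕂)`. -/
def AffineIndependentL0 {n : ℕ} [NeZero n] (x : Fin n → E) : Prop :=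
  LinearIndependent (Ω →ₘ[P] 𝕂) fun i : {i : Fin n // i ≠ 0} => x i - x 0

/-- `y` is the countable concatenation `∑ₗ I_{Aₗ} xₗ` of the sequence `x` along the partition
`A`, i.e. `I_{Aₗ} y = I_{Aₗ} xₗ` for every `l`. In a random normed module there is at most one
such `y`. -/
def IsConcatenation (A : CountablePartition Ω) (x : ℕ → E) (y : E) : Prop :=
  ∀ l, indL0 P 𝕂 (A.piece l) (A.measurableSet_piece l) • y =
    indL0 P 𝕂 (A.piece l) (A.measurableSet_piece l) • x l

/-- A map `T : G₁ → G₂` is `σ`-stable: `T (∑ₗ I_{Aₗ} xₗ) = ∑ₗ I_{Aₗ} T xₗ` for every sequence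
in `G₁` and every countable partition. -/
def SigmaStableMap {G₁ G₂ : Set E} (T : G₁ → G₂) : Prop :=
  ∀ (A : CountablePartition Ω) (x : ℕ → G₁) (y : G₁),
    IsConcatenation P 𝕂 A (fun l => (x l : E)) y →
      IsConcatenation P 𝕂 A (fun l => (T (x l) : E)) (T y)

/-- `y` is a random subsequence of `x`: `yₖ = ∑ₗ I_{(νₖ = l)} xₗ` for a sequence `νₖ` in
`L⁰(𝓕, ℕ)` that is strictly increasing on `Ω`. -/
def IsRandomSubsequence (x y : ℕ → E) : Prop :=
  ∃ ν : ℕ → (Ω →ₘ[P] ℕ), (∀ k, ∀ᵐ ω ∂P, ν k ω < ν (k + 1) ω) ∧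
    ∀ k, IsConcatenation P 𝕂 (levelPartition (ν k)) x (y k)

variable [RNModule P 𝕂 E]

/-- The basic neighbourhood `{x : P(‖x‖ < ε) > 1 - δ}` of the origin in the
`(ε, λ)`-topology. -/
def nhdZero (ε δ : ℝ) : Set E :=
  {x | 1 - δ < P.real {ω | (RNModule.rnorm 𝕂 x : Ω →ₘ[P] ℝ) ω < ε}}

/-- Convergence of a sequence in the `(ε, λ)`-topology, the linear topology for which the sets
`nhdZero P 𝕂 ε δ` with `ε > 0` and `0 < δ < 1` form a local base at the origin. -/
def TendstoEpsLambda (x : ℕ → E) (a : E) : Prop :=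
  ∀ ε δ : ℝ, 0 < ε → 0 < δ → δ < 1 → ∀ᶠ k in atTop, x k - a ∈ nhdZero P 𝕂 (E := E) ε δ

/-- A map `T : G₁ → G₂` is random sequentially continuous: whenever a sequence in `G₁` converges
in the `(ε, λ)`-topology to a point `a` of `G₁`, it has a random subsequence in `G₁` whose image
under `T` converges in the `(ε, λ)`-topology to `T a`. -/
def RandomSeqContinuous {G₁ G₂ : Set E} (T : G₁ → G₂) : Prop :=
  ∀ (a : G₁) (x : ℕ → G₁), TendstoEpsLambda P 𝕂 (fun k => (x k : E)) a →
    ∃ y : ℕ → G₁, IsRandomSubsequence P 𝕂 (fun k => (x k : E)) (fun k => (y k : E)) ∧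
      TendstoEpsLambda P 𝕂 (fun k => (T (y k) : E)) (T a)

end Module

end RandomBrouwer

end

/-! Coordinates turn the problem into a family of Brouwer problems, one for each ω, except that `f`
acts on random points as a whole and not ω by ω. The classical combinatorial proof survives because
it evaluates `f` only on the countably many deterministic grid points. At each ω, colour a grid
point by an index whose barycentric coordinate does not decrease under `f`. Scarf's parity argument
(`exists_isDominant_image_eq`, `exists_grid_points`) yields nearby grid points, the `i`-th of which
has colour `i` or a small `i`-th coordinate. The first suitable tuple in an enumeration depends
measurably on ω, and σ-stability evaluates `f` on the random points so selected
(`SigmaStableMap.exists_approx`).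

As the mesh tends to zero, a measurable Bolzano–Weierstrass theorem
(`exists_random_subsequence_tendsto`) provides a common random limit `Y` of these points. Random
sequential continuity gives, at almost every ω, images along a subsequence whose coordinates
converge to those of `f Y` (`RandomSeqContinuous.ae_exists_tendsto_coord`). Hence no coordinate of
`Y` exceeds the corresponding coordinate of `f Y`. Both families of coordinates sum to one, so they
agree almost surely. -/

noncomputable section

namespace RandomBrouwer

/-! ### Scarf's combinatorial lemma and the finite form of Brouwer's theorem. -/

section Scarf

variable {T I : Type*}

/-- The pair `(σ, C)` is dominant for the rankings `r i`, `i ∈ C`, of `T`: every `y` is ranked at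
most as high as all of `σ` by one of the rankings in `C`. -/
def IsDominant (r : I → T → ℕ) (p : Finset T × Finset I) : Prop :=
  ∀ y, ∃ i ∈ p.2, ∀ x ∈ p.1, r i y ≤ r i x

theorem IsDominant.mono {r : I → T → ℕ} {σ τ : Finset T} {C D : Finset I}
    (h : IsDominant r (σ, C)) (hτ : τ ⊆ σ) (hC : C ⊆ D) : IsDominant r (τ, D) := fun y => by
  obtain ⟨i, hi, hy⟩ := h y
  exact ⟨i, hC hi, fun x hx => hy x (hτ hx)⟩

variable [DecidableEq T]

/-- Dominance tested at a point `x` of `τ` itself makes `x` the minimiser of one of the rankings in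
`D`; injectivity of the ranking identifies it with the chosen minimiser. -/
theorem IsDominant.image_min_eq {r : I → T → ℕ} (hr : ∀ i, Function.Injective (r i))
    {τ : Finset T} {D : Finset I} (h : IsDominant r (τ, D)) {m : I → T}
    (hm : ∀ i ∈ D, m i ∈ τ) (hmin : ∀ i, ∀ x ∈ τ, r i (m i) ≤ r i x) : D.image m = τ := by
  ext x
  constructor
  · intro hx
    obtain ⟨i, hi, rfl⟩ := Finset.mem_image.1 hx
    exact hm i hi
  · intro hx
    obtain ⟨i, hi, h'⟩ := h x
    exact Finset.mem_image.2 ⟨i, hi, hr i (le_antisymm (hmin i x hx) (h' _ (hm i hi)))⟩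

variable [DecidableEq I]

/-- Incidence between rooms `(σ, C)` and doors `(τ, D)`: the door arises by removing a point or by
adding an index. -/
def IsDoorOf (d p : Finset T × Finset I) : Prop :=
  (∃ y ∉ d.1, p = (insert y d.1, d.2)) ∨ (∃ k ∈ d.2, p = (d.1, d.2.erase k))

/-- The room behind the door `(τ, D)` in direction `k`. -/
def IsRoomInDirection (r : I → T → ℕ) (m : I → T) (τ : Finset T) (D : Finset I) (k : I)
    (p : Finset T × Finset I) : Prop :=
  IsDominant r p ∧ (p = (τ, D.erase k) ∨
    ∃ y, p = (insert y τ, D) ∧ ∀ l ∈ D.erase k, r l (m l) < r l y)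

/-- If a point `y` is added, the minimisers of the enlarged set are distinct by counting, so `y` is
the minimiser for exactly one index of `D`. That index is the direction `k`; all other minimisers
remain unchanged. -/
theorem IsDoorOf.exists_isRoomInDirection {r : I → T → ℕ} (hr : ∀ i, Function.Injective (r i))
    {τ : Finset T} {D : Finset I} (hcard : D.card = τ.card + 1) {m : I → T}
    (hm : ∀ i, m i ∈ τ) (hmin : ∀ i, ∀ x ∈ τ, r i (m i) ≤ r i x)
    {p : Finset T × Finset I} (hp : IsDominant r p) (hd : IsDoorOf (τ, D) p) :
    ∃ k ∈ D, (D.erase k).image m = τ ∧ IsRoomInDirection r m τ D k p := by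
  classical
  rcases hd with ⟨y, hy, rfl⟩ | ⟨k, hk, rfl⟩
  · simp only at hy hp ⊢
    have hdoor : IsDominant r (τ, D) := hp.mono (Finset.subset_insert _ _) subset_rfl
    -- Minimisers over `insert y τ`.
    set m' : I → T := fun i => if r i y ≤ r i (m i) then y else m i with hm'
    have hm'1 : ∀ i, m' i = y ∨ m' i = m i := fun i => by simp only [hm']; split_ifs <;> simp
    have himg : D.image m' = insert y τ := by
      refine hp.image_min_eq hr (fun i _ => ?_) fun i x hx => ?_
      · rcases hm'1 i with h | h <;> simp [h, hm]
      · simp only [hm']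
        rcases Finset.mem_insert.1 hx with rfl | hx
        · split_ifs with h
          · exact le_rfl
          · exact (not_le.1 h).le
        · split_ifs with h
          · exact h.trans (hmin i x hx)
          · exact hmin i x hx
    have hinj : Set.InjOn m' D := by
      refine Finset.injOn_of_card_image_eq ?_
      rw [himg, Finset.card_insert_of_notMem hy, hcard]
    obtain ⟨k, hk, hky⟩ := Finset.mem_image.1 (himg ▸ Finset.mem_insert_self y τ)
    have hne : ∀ l ∈ D.erase k, m' l = m l := fun l hl => by
      refine (hm'1 l).resolve_left fun h => (Finset.mem_erase.1 hl).1 ?_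
      exact hinj (Finset.mem_of_mem_erase hl) hk (h.trans hky.symm)
    refine ⟨k, hk, ?_, hp, Or.inr ⟨y, rfl, fun l hl => ?_⟩⟩
    · ext x
      constructor
      · intro hx
        obtain ⟨l, _, rfl⟩ := Finset.mem_image.1 hx
        exact hm l
      · intro hx
        obtain ⟨l, hl, rfl⟩ := Finset.mem_image.1 (himg ▸ Finset.mem_insert_of_mem hx)
        have hlk : l ≠ k := by
          rintro rfl
          exact hy (hky ▸ hx)
        have hl' := Finset.mem_erase.2 ⟨hlk, hl⟩
        exact Finset.mem_image.2 ⟨l, hl', (hne l hl').symm⟩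
    · by_contra hcon
      have h1 : m' l = y := by simp only [hm']; rw [if_pos (not_lt.1 hcon)]
      exact hy (h1 ▸ hne l hl ▸ hm l)
  · exact ⟨k, hk, hp.image_min_eq hr (fun i _ => hm i) hmin, hp, Or.inl rfl⟩

/-- This is the pivot step. Only points above the minima in every direction of `D` except `k` may be
added. If there are none, `k` can be dropped; otherwise dominance forces the choice of the candidate
ranked highest by `r k`. -/
theorem existsUnique_isRoomInDirection [Fintype T] {r : I → T → ℕ} (hr : ∀ i, Function.Injective (r i))
    {τ : Finset T} {D : Finset I} (h : IsDominant r (τ, D)) {m : I → T}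
    (hm : ∀ i, m i ∈ τ) (hmin : ∀ i, ∀ x ∈ τ, r i (m i) ≤ r i x) {k : I} (hk : k ∈ D)
    (himg : (D.erase k).image m = τ) :
    ∃ p, IsRoomInDirection r m τ D k p ∧ IsDoorOf (τ, D) p ∧
      ∀ q, IsRoomInDirection r m τ D k q → q = p := by
  classical
  have hnot : ∀ y, (∀ l ∈ D.erase k, r l (m l) < r l y) → y ∉ τ := fun y hy hyτ => by
    rw [← himg, Finset.mem_image] at hyτ
    obtain ⟨l, hl, rfl⟩ := hyτ
    exact lt_irrefl _ (hy l hl)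
  have hk_le : ∀ y, (∀ l ∈ D.erase k, r l (m l) < r l y) → r k y ≤ r k (m k) := fun y hy => by
    obtain ⟨l, hl, hl'⟩ := h y
    by_cases hlk : l = k
    · subst hlk; exact hl' _ (hm _)
    · exact absurd (hl' _ (hm l)) (not_le.2 (hy l (Finset.mem_erase.2 ⟨hlk, hl⟩)))
  set M : Finset T := Finset.univ.filter fun y => ∀ l ∈ D.erase k, r l (m l) < r l y with hM
  have memM : ∀ y, y ∈ M ↔ ∀ l ∈ D.erase k, r l (m l) < r l y := fun y => by simp [hM]
  rcases M.eq_empty_or_nonempty with hE | hN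
  · refine ⟨(τ, D.erase k), ⟨fun y => ?_, Or.inl rfl⟩, Or.inr ⟨k, hk, rfl⟩, ?_⟩
    · have : y ∉ M := by simp [hE]
      rw [memM] at this
      push Not at this
      obtain ⟨l, hl, hl'⟩ := this
      exact ⟨l, hl, fun x hx => hl'.trans (hmin l x hx)⟩
    · rintro q ⟨-, rfl | ⟨y, rfl, hy⟩⟩
      · rfl
      · rw [← memM, hE] at hy
        simp at hy
  · obtain ⟨y, hyM, hymax⟩ := M.exists_max_image (r k) hN
    have hy := (memM y).1 hyM
    refine ⟨(insert y τ, D), ⟨fun z => ?_, Or.inr ⟨y, rfl, hy⟩⟩,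
      Or.inl ⟨y, hnot y hy, rfl⟩, ?_⟩
    · by_cases hz : z ∈ M
      · refine ⟨k, hk, fun x hx => ?_⟩
        rcases Finset.mem_insert.1 hx with rfl | hx
        · exact hymax z hz
        · exact (hk_le z ((memM z).1 hz)).trans (hmin k x hx)
      · rw [memM] at hz
        push Not at hz
        obtain ⟨l, hl, hl'⟩ := hz
        refine ⟨l, Finset.mem_of_mem_erase hl, fun x hx => ?_⟩
        rcases Finset.mem_insert.1 hx with rfl | hx
        · exact hl'.trans (hy l hl).le
        · exact hl'.trans (hmin l x hx)
    · rintro q ⟨hq, rfl | ⟨z, rfl, hz⟩⟩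
      · obtain ⟨l, hl, hl'⟩ := hq y
        exact absurd (hl' _ (hm l)) (not_le.2 (hy l hl))
      · obtain ⟨l, hl, hl'⟩ := hq y
        by_cases hlk : l = k
        · subst hlk
          have h1 := hl' z (Finset.mem_insert_self _ _)
          have h2 := hymax z ((memM z).2 hz)
          rw [hr l (le_antisymm h1 h2)]
        · exact absurd (hl' _ (Finset.mem_insert_of_mem (hm l)))
            (not_le.2 (hy l (Finset.mem_erase.2 ⟨hlk, hl⟩)))

/-- A door with at least one point opens into exactly two rooms. -/
theorem card_rooms_of_door [Fintype T] {r : I → T → ℕ} (hr : ∀ i, Function.Injective (r i))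
    {τ : Finset T} {D : Finset I} (h : IsDominant r (τ, D)) (hcard : D.card = τ.card + 1)
    (hτ : τ.Nonempty) (R : Finset (Finset T × Finset I))
    (hR : ∀ p, p ∈ R ↔ IsDominant r p ∧ IsDoorOf (τ, D) p) : R.card = 2 := by
  classical
  choose m hm hmin using fun i => τ.exists_min_image (r i) hτ
  have himg := h.image_min_eq hr (fun i _ => hm i) hmin
  -- The minimiser map sends `D` onto `τ`, which has one element less, so exactly one pair of
  -- indices collides. These two indices are the only possible directions.
  obtain ⟨i, hi, j, hj, hij, hmij⟩ := Finset.exists_ne_map_eq_of_card_lt_of_maps_to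
    (s := D) (t := τ) (by omega) (f := m) (fun i _ => hm i)
  have key : ∀ i ∈ D, ∀ j ∈ D, i ≠ j → m i = m j → (D.erase i).image m = τ := by
    intro i hi j hj hij hmij
    rw [← himg]
    ext x
    simp only [Finset.mem_image, Finset.mem_erase]
    constructor
    · rintro ⟨l, hl, rfl⟩; exact ⟨l, hl.2, rfl⟩
    · rintro ⟨l, hl, rfl⟩
      by_cases hli : l = i
      · subst hli; exact ⟨j, ⟨hij.symm, hj⟩, hmij.symm⟩
      · exact ⟨l, ⟨hli, hl⟩, rfl⟩
  have hinj : Set.InjOn m (D.erase i) := by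
    refine Finset.injOn_of_card_image_eq ?_
    rw [key i hi j hj hij hmij, Finset.card_erase_of_mem hi]
    omega
  have hdir : ∀ k ∈ D, (D.erase k).image m = τ → k = i ∨ k = j := by
    intro k hk hk'
    by_contra hcon
    push Not at hcon
    obtain ⟨l, hl, hlk⟩ := Finset.mem_image.1 (hk' ▸ hm k : m k ∈ (D.erase k).image m)
    obtain ⟨hl1, hl2⟩ := Finset.mem_erase.1 hl
    have hkm : k ∈ (↑(D.erase i) : Set I) := by simp [hcon.1, hk]
    have hjm : j ∈ (↑(D.erase i) : Set I) := by simp [hij.symm, hj]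
    by_cases hli : l = i
    · subst hli
      exact hcon.2 (hinj hkm hjm (hlk.symm.trans hmij))
    · exact hl1 (hinj (by simp [hli, hl2]) hkm hlk)
  obtain ⟨p, hp, hpd, hpu⟩ := existsUnique_isRoomInDirection hr h hm hmin hi
    (key i hi j hj hij hmij)
  obtain ⟨q, hq, hqd, hqu⟩ := existsUnique_isRoomInDirection hr h hm hmin hj
    (key j hj i hi hij.symm hmij.symm)
  -- The rooms could coincide only if the same `y` were added in both directions; then `y` would
  -- beat the minimum in every direction of `D`, against dominance of the door.
  have hpq : p ≠ q := by
    rintro rfl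
    have nq : ∀ (k : I), k ∈ D → ∀ y, (insert y τ, D) ≠ (τ, D.erase k) := fun k hk y h => by
      have := (Prod.ext_iff.1 h).2
      simp only at this
      exact Finset.notMem_erase k D (this ▸ hk)
    rcases hp.2 with rfl | ⟨y, rfl, hy⟩
    · rcases hq.2 with h' | ⟨z, h', -⟩
      · have := (Prod.ext_iff.1 h').2
        simp only at this
        exact Finset.notMem_erase i D (this ▸ Finset.mem_erase.2 ⟨hij, hi⟩)
      · exact nq i hi z h'.symm
    · rcases hq.2 with h' | ⟨z, h', hz⟩
      · exact nq j hj y h'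
      · have h1 := (Prod.ext_iff.1 h').1
        simp only at h1
        have hyτ : y ∉ τ := by
          rw [← key i hi j hj hij hmij, Finset.mem_image]
          rintro ⟨l, hl, rfl⟩
          exact lt_irrefl _ (hy l hl)
        have hyz : y = z := by
          have : y ∈ insert z τ := h1 ▸ Finset.mem_insert_self y τ
          exact (Finset.mem_insert.1 this).resolve_right hyτ
        subst hyz
        obtain ⟨l, hl, hl'⟩ := h y
        by_cases hli : l = i
        · subst hli
          exact absurd (hl' _ (hm l)) (not_le.2 (hz l (Finset.mem_erase.2 ⟨hij, hl⟩)))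
        · exact absurd (hl' _ (hm l)) (not_le.2 (hy l (Finset.mem_erase.2 ⟨hli, hl⟩)))
  have : R = {p, q} := by
    ext s
    rw [hR, Finset.mem_insert, Finset.mem_singleton]
    constructor
    · rintro ⟨hs, hsd⟩
      obtain ⟨k, hk, hk', hs'⟩ := hsd.exists_isRoomInDirection hr hcard hm hmin hs
      rcases hdir k hk hk' with rfl | rfl
      · exact Or.inl (hpu s hs')
      · exact Or.inr (hqu s hs')
    · rintro (rfl | rfl)
      · exact ⟨hp.1, hpd⟩
      · exact ⟨hq.1, hqd⟩
  rw [this, Finset.card_pair hpq]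

/-- A door is almost coloured of type `i` if its points carry exactly the colours of its index set
other than `i`. -/
def IsAlmostColoured (c : T → I) (i : I) (d : Finset T × Finset I) : Prop :=
  d.2.card = d.1.card + 1 ∧ i ∈ d.2 ∧ d.1.image c = d.2.erase i

theorem isDoorOf_iff {d p : Finset T × Finset I} :
    IsDoorOf d p ↔ (∃ x ∈ p.1, d = (p.1.erase x, p.2)) ∨ (∃ k ∉ p.2, d = (p.1, insert k p.2)) := by
  obtain ⟨τ, D⟩ := d
  obtain ⟨σ, C⟩ := p
  simp only [IsDoorOf, Prod.mk.injEq]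
  constructor
  · rintro (⟨y, hy, rfl, rfl⟩ | ⟨k, hk, rfl, rfl⟩)
    · exact Or.inl ⟨y, Finset.mem_insert_self _ _, (Finset.erase_insert hy).symm, rfl⟩
    · exact Or.inr ⟨k, Finset.notMem_erase _ _, rfl, (Finset.insert_erase hk).symm⟩
  · rintro (⟨y, hy, rfl, rfl⟩ | ⟨k, hk, rfl, rfl⟩)
    · exact Or.inl ⟨y, Finset.notMem_erase _ _, (Finset.insert_erase hy).symm, rfl⟩
    · exact Or.inr ⟨k, Finset.mem_insert_self _ _, rfl, (Finset.erase_insert hk).symm⟩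

/-- A room which is not completely coloured has an even number of almost coloured doors. -/
theorem even_card_doors_of_room (c : T → I) (i : I) {p : Finset T × Finset I}
    (hcard : p.1.card = p.2.card) (hne : p.1.image c ≠ p.2) (S : Finset (Finset T × Finset I))
    (hS : ∀ d, d ∈ S ↔ IsDoorOf d p ∧ IsAlmostColoured c i d) : Even S.card := by
  obtain ⟨σ, C⟩ := p
  simp only at hcard hne
  have hS' : ∀ d, d ∈ S ↔
      (∃ x ∈ σ, d = (σ.erase x, C) ∧ i ∈ C ∧ (σ.erase x).image c = C.erase i) ∨
      (∃ j ∉ C, d = (σ, insert j C) ∧ i ∈ C ∧ σ.image c = insert j (C.erase i)) := by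
    intro d
    rw [hS, isDoorOf_iff]
    constructor
    · rintro ⟨⟨x, hx, rfl⟩ | ⟨j, hj, rfl⟩, -, h2, h3⟩
      · exact Or.inl ⟨x, hx, rfl, h2, h3⟩
      · simp only at h2 h3 hj
        -- Adding `i` itself would require the colours of `σ` to be exactly `C`, which `hne`
        -- excludes.
        have hij : i ≠ j := by
          rintro rfl
          rw [Finset.erase_insert hj] at h3
          exact hne h3
        refine Or.inr ⟨j, hj, rfl, Finset.mem_of_mem_insert_of_ne h2 hij, ?_⟩
        rw [h3, Finset.erase_insert_of_ne hij.symm]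
    · rintro (⟨x, hx, rfl, h2, h3⟩ | ⟨j, hj, rfl, h2, h3⟩)
      · refine ⟨Or.inl ⟨x, hx, rfl⟩, ?_, h2, h3⟩
        simp only
        rw [Finset.card_erase_add_one hx, hcard]
      · refine ⟨Or.inr ⟨j, hj, rfl⟩, ?_, Finset.mem_insert_of_mem h2, ?_⟩
        · simp only
          rw [Finset.card_insert_of_notMem hj, hcard]
        · have hij : j ≠ i := by
            rintro rfl
            exact hj h2
          simp only
          rw [h3, Finset.erase_insert_of_ne hij]
  by_cases hi : i ∈ C
  swap
  · have : S = ∅ := by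
      ext d
      rw [hS']
      simp [hi]
    simp [this]
  have hCe : (C.erase i).card + 1 = C.card := Finset.card_erase_add_one hi
  -- Here one colour occurs twice, and the two doors arise by deleting either of its points.
  by_cases ha : σ.image c = C.erase i
  · obtain ⟨x, hx, x', hx', hxx, hcx⟩ := Finset.exists_ne_map_eq_of_card_lt_of_maps_to
      (s := σ) (t := C.erase i) (by omega) (f := c)
      (fun y hy => ha ▸ Finset.mem_image_of_mem c hy)
    have key : ∀ x ∈ σ, ∀ x' ∈ σ, x ≠ x' → c x = c x' → (σ.erase x).image c = C.erase i := by
      intro x hx x' hx' hxx hcx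
      rw [← ha]
      ext z
      simp only [Finset.mem_image, Finset.mem_erase]
      constructor
      · rintro ⟨l, hl, rfl⟩; exact ⟨l, hl.2, rfl⟩
      · rintro ⟨l, hl, rfl⟩
        by_cases hlx : l = x
        · subst hlx; exact ⟨x', ⟨hxx.symm, hx'⟩, hcx.symm⟩
        · exact ⟨l, ⟨hlx, hl⟩, rfl⟩
    have h1 := key x hx x' hx' hxx hcx
    have h2 := key x' hx' x hx hxx.symm hcx.symm
    have hinj : Set.InjOn c (σ.erase x) := by
      refine Finset.injOn_of_card_image_eq ?_
      rw [h1, Finset.card_erase_of_mem hx]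
      omega
    have : S = {(σ.erase x, C), (σ.erase x', C)} := by
      ext d
      rw [hS', Finset.mem_insert, Finset.mem_singleton]
      constructor
      · rintro (⟨y, hy, rfl, -, hy2⟩ | ⟨j, hj, rfl, -, hj2⟩)
        · by_contra hcon
          push Not at hcon
          have hyx : y ≠ x := by
            rintro rfl
            exact hcon.1 rfl
          have hyx' : y ≠ x' := by
            rintro rfl
            exact hcon.2 rfl
          have hcy : c y ∈ (σ.erase y).image c := by
            rw [hy2, ← ha]; exact Finset.mem_image_of_mem c hy
          obtain ⟨z, hz, hzy⟩ := Finset.mem_image.1 hcy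
          obtain ⟨hz1, hz2⟩ := Finset.mem_erase.1 hz
          have hyσ : y ∈ (↑(σ.erase x) : Set T) := by simp [hyx, hy]
          by_cases hzx : z = x
          · subst hzx
            exact hyx' (hinj hyσ (by simp [hxx.symm, hx']) (hzy.symm.trans hcx))
          · exact hz1 (hinj (by simp [hzx, hz2]) hyσ hzy)
        · rw [ha] at hj2
          have : j ∈ C.erase i := by
            rw [hj2]; exact Finset.mem_insert_self _ _
          exact absurd (Finset.mem_of_mem_erase this) hj
      · rintro (rfl | rfl)
        · exact Or.inl ⟨x, hx, rfl, hi, h1⟩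
        · exact Or.inl ⟨x', hx', rfl, hi, h2⟩
    rw [this, Finset.card_pair]
    · exact even_two
    · intro h
      have h' := (Prod.ext_iff.1 h).1
      simp only at h'
      exact Finset.notMem_erase x' σ (h' ▸ Finset.mem_erase.2 ⟨hxx.symm, hx'⟩)
  -- Here the colours are distinct with one foreign colour `j`: either delete its point or add `j`
  -- to the index set.
  by_cases hb : ∃ j ∉ C, σ.image c = insert j (C.erase i)
  · obtain ⟨j, hj, hj2⟩ := hb
    have hjC : j ∉ C.erase i := fun h => hj (Finset.mem_of_mem_erase h)
    have hinj : Set.InjOn c σ := by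
      refine Finset.injOn_of_card_image_eq ?_
      rw [hj2, Finset.card_insert_of_notMem hjC]
      omega
    obtain ⟨x, hx, hxj⟩ := Finset.mem_image.1 (hj2 ▸ Finset.mem_insert_self j (C.erase i))
    have hx2 : (σ.erase x).image c = C.erase i := by
      rw [Finset.erase_eq, Finset.image_sdiff_of_injOn hinj (by simpa using hx), hj2,
        Finset.image_singleton, hxj, ← Finset.erase_eq, Finset.erase_insert hjC]
    have : S = {(σ.erase x, C), (σ, insert j C)} := by
      ext d
      rw [hS', Finset.mem_insert, Finset.mem_singleton]
      constructor
      · rintro (⟨y, hy, rfl, -, hy2⟩ | ⟨k, hk, rfl, -, hk2⟩)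
        · left
          by_cases hyx : y = x
          · rw [hyx]
          · have : c x ∈ (σ.erase y).image c :=
              Finset.mem_image_of_mem c (Finset.mem_erase.2 ⟨fun h => hyx h.symm, hx⟩)
            rw [hy2, hxj] at this
            exact absurd this hjC
        · right
          have : k ∈ insert j (C.erase i) := hj2 ▸ hk2 ▸ Finset.mem_insert_self k _
          rcases Finset.mem_insert.1 this with rfl | h
          · rfl
          · exact absurd (Finset.mem_of_mem_erase h) hk
      · rintro (rfl | rfl)
        · exact Or.inl ⟨x, hx, rfl, hi, hx2⟩
        · exact Or.inr ⟨j, hj, rfl, hi, hj2⟩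
    rw [this, Finset.card_pair]
    · exact even_two
    · intro h
      have h' := (Prod.ext_iff.1 h).1
      simp only at h'
      have : x ∉ σ := by
        rw [← h']; exact Finset.notMem_erase x σ
      exact this hx
  · have : S = ∅ := by
      refine Finset.eq_empty_of_forall_notMem fun d hd => ?_
      rcases (hS' d).1 hd with ⟨x, hx, -, -, hx2⟩ | ⟨j, hj, -, -, hj2⟩
      · have h1 : σ.image c = insert (c x) (C.erase i) := by
          rw [← hx2, ← Finset.image_insert, Finset.insert_erase hx]
        by_cases hxi : c x = i
        · rw [hxi, Finset.insert_erase hi] at h1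
          exact hne h1
        by_cases hxC : c x ∈ C
        · rw [Finset.insert_eq_of_mem (Finset.mem_erase.2 ⟨hxi, hxC⟩)] at h1
          exact ha h1
        · exact hb ⟨c x, hxC, h1⟩
      · exact hb ⟨j, hj, hj2⟩
    simp [this]

/-- **Scarf's lemma.** Every colouring of a finite set by the indices of finitely many rankings
admits a dominant pair `(σ, C)` such that `C` is the set of colours of `σ`. -/
theorem exists_isDominant_image_eq [Fintype T] [Fintype I] [Nonempty T] [Nonempty I]
    {r : I → T → ℕ} (hr : ∀ i, Function.Injective (r i)) (c : T → I) :
    ∃ p, IsDominant r p ∧ p.1.image c = p.2 := by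
  classical
  obtain ⟨i⟩ := ‹Nonempty I›
  by_contra hcon
  push Not at hcon
  set rooms : Finset (Finset T × Finset I) :=
    Finset.univ.filter fun p => IsDominant r p ∧ p.1.card = p.2.card
  set doors : Finset (Finset T × Finset I) :=
    Finset.univ.filter fun d => IsDominant r d ∧ IsAlmostColoured c i d
  have hrooms : ∀ p ∈ rooms, Even (doors.filter fun d => IsDoorOf d p).card := by
    intro p hp
    simp only [rooms, Finset.mem_filter, Finset.mem_univ, true_and] at hp
    refine even_card_doors_of_room c i hp.2 (hcon p hp.1) _ fun d => ?_
    simp only [doors, Finset.mem_filter, Finset.mem_univ, true_and]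
    constructor
    · rintro ⟨⟨-, h1⟩, h2⟩; exact ⟨h2, h1⟩
    · rintro ⟨h2, h1⟩
      refine ⟨⟨?_, h1⟩, h2⟩
      rcases isDoorOf_iff.1 h2 with ⟨x, hx, rfl⟩ | ⟨k, hk, rfl⟩
      · exact hp.1.mono (Finset.erase_subset _ _) subset_rfl
      · exact hp.1.mono subset_rfl (Finset.subset_insert _ _)
  have hmem : ∀ d ∈ doors, ∀ p, p ∈ rooms.filter (fun p => IsDoorOf d p) ↔
      IsDominant r p ∧ IsDoorOf d p := by
    intro d hd p
    simp only [doors, Finset.mem_filter, Finset.mem_univ, true_and] at hd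
    simp only [rooms, Finset.mem_filter, Finset.mem_univ, true_and]
    constructor
    · rintro ⟨⟨h1, -⟩, h2⟩; exact ⟨h1, h2⟩
    · rintro ⟨h1, h2⟩
      refine ⟨⟨h1, ?_⟩, h2⟩
      have hc := hd.2.1
      rcases h2 with ⟨y, hy, rfl⟩ | ⟨k, hk, rfl⟩
      · simp only
        rw [Finset.card_insert_of_notMem hy, hc]
      · simp only
        rw [Finset.card_erase_of_mem hk, hc, Nat.add_sub_cancel]
  -- The only almost coloured door of type `i` without points. It opens into a single room, given by
  -- the point that `r i` ranks highest, while every other door counts twice; the double count of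
  -- incidences is therefore odd.
  set o : Finset T × Finset I := (∅, {i}) with ho
  have hod : o ∈ doors := by
    simp only [doors, Finset.mem_filter, Finset.mem_univ, true_and, ho]
    exact ⟨fun y => ⟨i, by simp, by simp⟩, by simp [IsAlmostColoured]⟩
  have houter : (rooms.filter fun p => IsDoorOf o p).card = 1 := by
    obtain ⟨t, -, ht⟩ := (Finset.univ : Finset T).exists_max_image (r i) Finset.univ_nonempty
    rw [Finset.card_eq_one]
    refine ⟨({t}, {i}), ?_⟩
    ext p
    rw [hmem o hod, Finset.mem_singleton]
    constructor
    · rintro ⟨h1, ⟨y, hy, rfl⟩ | ⟨k, hk, rfl⟩⟩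
      · obtain ⟨l, hl, hl'⟩ := h1 t
        simp only [ho, Finset.mem_singleton] at hl
        subst hl
        have h1 := hl' y (by simp)
        rw [hr l (le_antisymm h1 (ht y (Finset.mem_univ y)))]
        simp [ho]
      · simp only [ho, Finset.mem_singleton] at hk
        subst hk
        obtain ⟨l, hl, -⟩ := h1 t
        simp [ho] at hl
    · rintro rfl
      refine ⟨fun y => ⟨i, by simp, fun x hx => ?_⟩, Or.inl ⟨t, by simp [ho], by simp [ho]⟩⟩
      rw [Finset.mem_singleton] at hx
      subst hx
      exact ht y (Finset.mem_univ y)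
  have hinner : ∀ d ∈ doors.erase o, (rooms.filter fun p => IsDoorOf d p).card = 2 := by
    intro d hd
    obtain ⟨hdo, hd⟩ := Finset.mem_erase.1 hd
    have hd' := hd
    simp only [doors, Finset.mem_filter, Finset.mem_univ, true_and] at hd'
    obtain ⟨h1, h2, h3, h4⟩ := hd'
    refine card_rooms_of_door (τ := d.1) (D := d.2) hr h1 h2 ?_ _ (hmem d hd)
    rw [Finset.nonempty_iff_ne_empty]
    intro h0
    refine hdo (Prod.ext h0 ?_)
    rw [h0, Finset.image_empty] at h4
    rw [← Finset.insert_erase h3, ← h4]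
    simp [ho]
  have hsum := Finset.sum_card_bipartiteAbove_eq_sum_card_bipartiteBelow (s := doors) (t := rooms)
    (fun d p => IsDoorOf d p)
  simp only [Finset.bipartiteAbove, Finset.bipartiteBelow] at hsum
  have heven : Even (∑ p ∈ rooms, (doors.filter fun d => IsDoorOf d p).card) :=
    Finset.even_sum _ hrooms
  rw [← hsum, ← Finset.add_sum_erase _ _ hod, houter, Finset.sum_congr rfl hinner,
    Finset.sum_const, smul_eq_mul] at heven
  rw [Nat.even_iff] at heven
  omega

/-- A finite form of Brouwer's theorem on the grid `{v ∈ ℕⁿ : ∑ vⱼ = N}`: for every colouring there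
are nearby grid points `v i` such that `v i` has colour `i` or small `i`-th coordinate. -/
theorem exists_grid_points {n : ℕ} [NeZero n] (N : ℕ) (c : (Fin n → ℕ) → Fin n) :
    ∃ v : Fin n → Fin n → ℕ, (∀ i, ∑ j, v i j = N) ∧ (∀ i, c (v i) = i ∨ v i i ≤ n) ∧
      ∀ i i' j, v i j ≤ v i' j + n := by
  classical
  set G : Finset (Fin n → ℕ) := Finset.univ.piAntidiag N
  have hG : ∀ v, v ∈ G ↔ ∑ j, v j = N := fun v => by simp [G]
  have : Nonempty G := ⟨⟨Pi.single 0 N, (hG _).2 (by simp)⟩⟩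
  set K := Fintype.card G
  let e : G ≃ Fin K := Fintype.equivFin G
  -- Ranking by the `i`-th coordinate, with ties broken by the enumeration `e`, whose values lie
  -- below `K`.
  let r : Fin n → G → ℕ := fun i v => v.1 i * K + e v
  have hr : ∀ i, Function.Injective (r i) := by
    intro i v w h
    have h1 := congrArg (· % K) h
    simp only [r, Nat.mul_add_mod_self_right, Nat.mod_eq_of_lt (e v).2,
      Nat.mod_eq_of_lt (e w).2] at h1
    exact e.injective (Fin.ext h1)
  have hrle : ∀ i (v w : G), r i v ≤ r i w → v.1 i ≤ w.1 i := by
    intro i v w h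
    by_contra hlt
    push Not at hlt
    have h1 : (w.1 i + 1) * K ≤ v.1 i * K := Nat.mul_le_mul_right K hlt
    have h2 := (e w).2
    simp only [r] at h
    nlinarith
  obtain ⟨⟨σ, C⟩, hdom, himg⟩ := exists_isDominant_image_eq hr (fun v : G => c v.1)
  simp only at himg
  have hσ : σ.Nonempty := by
    obtain ⟨i, hi, -⟩ := hdom (Classical.arbitrary G)
    rw [← himg] at hi
    obtain ⟨x, hx, -⟩ := Finset.mem_image.1 hi
    exact ⟨x, hx⟩
  have hC : C.Nonempty := himg ▸ hσ.image _
  choose m hmσ hmin using fun i => σ.exists_min_image (fun v : G => v.1 i) hσ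
  -- Otherwise some grid point exceeds the minimum over `σ` in every coordinate of `C`, against
  -- dominance. The surplus needed to reach the sum `N` is put on `k₀`.
  have hsum : N < ∑ k ∈ C, ((m k).1 k + 1) := by
    by_contra hle
    push Not at hle
    obtain ⟨k₀, hk₀⟩ := hC
    set y : Fin n → ℕ := fun k => if k ∈ C then (m k).1 k + 1 +
      (if k = k₀ then N - ∑ k ∈ C, ((m k).1 k + 1) else 0) else 0
    have hy : ∑ k, y k = N := by
      simp only [y]
      rw [Finset.sum_ite_mem, Finset.univ_inter, Finset.sum_add_distrib, Finset.sum_ite_eq' C k₀,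
        if_pos hk₀]
      omega
    obtain ⟨k, hk, hk'⟩ := hdom ⟨y, (hG y).2 hy⟩
    have := hrle k _ _ (hk' (m k) (hmσ k))
    simp only [y, if_pos hk] at this
    omega
  have hcardC : C.card ≤ n := by simpa using C.card_le_univ
  rw [Finset.sum_add_distrib, Finset.sum_const, smul_eq_mul, mul_one] at hsum
  -- The minima over `C` already use up all of `N` but less than `C.card ≤ n`, which bounds both the
  -- spread within `C` and the coordinates outside `C`.
  have hin : ∀ x ∈ σ, ∀ k ∈ C, x.1 k ≤ (m k).1 k + n := by
    intro x hx k hk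
    have h1 : ∑ k ∈ C, x.1 k ≤ N := by
      rw [← (hG x.1).1 x.2]
      exact Finset.sum_le_univ_sum_of_nonneg fun _ => Nat.zero_le _
    rw [← Finset.add_sum_erase _ _ hk] at h1 hsum
    have h2 : ∑ k ∈ C.erase k, (m k).1 k ≤ ∑ k ∈ C.erase k, x.1 k :=
      Finset.sum_le_sum fun l _ => hmin l x hx
    omega
  have hout : ∀ x ∈ σ, ∀ k ∉ C, x.1 k ≤ n := by
    intro x hx k hk
    have h1 : ∑ k ∈ insert k C, x.1 k ≤ N := by
      rw [← (hG x.1).1 x.2]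
      exact Finset.sum_le_univ_sum_of_nonneg fun _ => Nat.zero_le _
    rw [Finset.sum_insert hk] at h1
    have h2 : ∑ k ∈ C, (m k).1 k ≤ ∑ k ∈ C, x.1 k :=
      Finset.sum_le_sum fun l _ => hmin l x hx
    omega
  have hsel : ∀ i, ∃ x ∈ σ, c x.1 = i ∨ x.1 i ≤ n := by
    intro i
    by_cases hi : i ∈ C
    · rw [← himg] at hi
      obtain ⟨x, hx, hxi⟩ := Finset.mem_image.1 hi
      exact ⟨x, hx, Or.inl hxi⟩
    · obtain ⟨x, hx⟩ := hσ
      exact ⟨x, hx, Or.inr (hout x hx i hi)⟩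
  choose v hvσ hv using hsel
  refine ⟨fun i => (v i).1, fun i => (hG _).1 (v i).2, hv, fun i i' j => ?_⟩
  beta_reduce
  by_cases hj : j ∈ C
  · have h1 := hin _ (hvσ i) j hj
    have h2 := hmin j _ (hvσ i')
    omega
  · have := hout _ (hvσ i) j hj
    omega

end Scarf

/-! ### Measurable selection and random subsequences. -/

section Selection

variable {Ω : Type*} [MeasurableSpace Ω]

theorem measurable_select {α : Type*} [MeasurableSpace α] {u : ℕ → Ω → α}
    (hu : ∀ m, Measurable (u m)) {ν : Ω → ℕ} (hν : Measurable ν) :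
    Measurable fun ω => u (ν ω) ω :=
  (measurable_from_prod_countable_right (f := fun p : ℕ × Ω => u p.1 p.2) hu).comp
    (hν.prodMk measurable_id)

/-- Randomized Bolzano–Weierstrass theorem for real random variables. -/
theorem exists_random_subsequence_tendsto_real {u : ℕ → Ω → ℝ} (hu : ∀ m, Measurable (u m))
    {B : ℝ} (hB : ∀ m ω, |u m ω| ≤ B) :
    ∃ (ν : ℕ → Ω → ℕ) (y : Ω → ℝ), (∀ k, Measurable (ν k)) ∧ (∀ k ω, k ≤ ν k ω) ∧
      ∀ ω, Tendsto (fun k => u (ν k ω) ω) atTop (nhds (y ω)) := by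
  classical
  -- The limsup is a cluster point that is measurable in ω; the least index close to it is then
  -- measurable too.
  set y : Ω → ℝ := fun ω => limsup (fun m => u m ω) atTop with hy
  have hym : Measurable y := Measurable.limsup hu
  have hbdd : ∀ ω, IsBoundedUnder (· ≤ ·) atTop fun m => u m ω := fun ω =>
    isBoundedUnder_of ⟨B, fun m => (abs_le.1 (hB m ω)).2⟩
  have hbdd' : ∀ ω, IsBoundedUnder (· ≥ ·) atTop fun m => u m ω := fun ω =>
    isBoundedUnder_of ⟨-B, fun m => (abs_le.1 (hB m ω)).1⟩
  have hex : ∀ (k : ℕ) ω, ∃ m, k ≤ m ∧ |u m ω - y ω| < 1 / ((k : ℝ) + 1) := by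
    intro k ω
    have hpos : (0 : ℝ) < 1 / ((k : ℝ) + 1) := by positivity
    have h1 : ∃ᶠ m in atTop, y ω - 1 / ((k : ℝ) + 1) < u m ω :=
      frequently_lt_of_lt_limsup (hbdd' ω).isCoboundedUnder_le (by simp only [hy]; linarith)
    have h2 : ∀ᶠ m in atTop, u m ω < y ω + 1 / ((k : ℝ) + 1) :=
      eventually_lt_of_limsup_lt (by simp only [hy]; linarith) (hbdd ω)
    obtain ⟨m, hm1, hm2, hm3⟩ := (h1.and_eventually (h2.and (eventually_ge_atTop k))).exists
    exact ⟨m, hm3, abs_lt.2 ⟨by linarith, by linarith⟩⟩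
  refine ⟨fun k ω => Nat.find (hex k ω), y, fun k => ?_, fun k ω => (Nat.find_spec (hex k ω)).1,
    fun ω => ?_⟩
  · refine measurable_find (hex k) fun m => ?_
    refine (MeasurableSet.const (k ≤ m)).inter ?_
    exact measurableSet_lt ((hu m).sub hym).abs measurable_const
  · rw [tendsto_iff_dist_tendsto_zero]
    refine squeeze_zero (fun _ => dist_nonneg) (fun k => ?_) tendsto_one_div_add_atTop_nhds_zero_nat
    exact (Nat.find_spec (hex k ω)).2.le

/-- Randomized Bolzano–Weierstrass theorem for random vectors. -/
theorem exists_random_subsequence_tendsto {ι : Type*} [Fintype ι] {u : ℕ → Ω → ι → ℝ}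
    (hu : ∀ m, Measurable (u m)) {B : ℝ} (hB : ∀ m ω i, |u m ω i| ≤ B) :
    ∃ (ν : ℕ → Ω → ℕ) (y : Ω → ι → ℝ), (∀ k, Measurable (ν k)) ∧ (∀ k ω, k ≤ ν k ω) ∧
      Measurable y ∧ ∀ ω, Tendsto (fun k => u (ν k ω) ω) atTop (nhds (y ω)) := by
  classical
  have key : ∀ s : Finset ι, ∃ (ν : ℕ → Ω → ℕ) (y : Ω → ι → ℝ), (∀ k, Measurable (ν k)) ∧
      (∀ k ω, k ≤ ν k ω) ∧
      ∀ i ∈ s, ∀ ω, Tendsto (fun k => u (ν k ω) ω i) atTop (nhds (y ω i)) := by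
    intro s
    induction s using Finset.induction_on with
    | empty => exact ⟨fun k _ => k, 0, fun _ => measurable_const, fun _ _ => le_rfl, by simp⟩
    | insert j s hj ih =>
      obtain ⟨ν, y, hν, hνk, hy⟩ := ih
      obtain ⟨μ, z, hμ, hμk, hz⟩ := exists_random_subsequence_tendsto_real
        (u := fun k ω => u (ν k ω) ω j)
        (fun k => (measurable_pi_apply j).comp (measurable_select hu (hν k)))
        (fun k ω => hB _ ω j)
      -- Passing to a further random subsequence keeps the limits of the coordinates already
      -- treated.
      refine ⟨fun k ω => ν (μ k ω) ω, fun ω => Function.update (y ω) j (z ω),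
        fun k => measurable_select hν (hμ k), fun k ω => (hμk k ω).trans (hνk _ ω),
        fun i hi ω => ?_⟩
      beta_reduce
      by_cases hij : i = j
      · subst hij
        simpa using hz ω
      · rw [Function.update_of_ne hij]
        exact (hy i (Finset.mem_of_mem_insert_of_ne hi hij) ω).comp
          (tendsto_atTop_mono (fun k => hμk k ω) tendsto_id)
  obtain ⟨ν, y, hν, hνk, hy⟩ := key Finset.univ
  have hlim : ∀ ω, Tendsto (fun k => u (ν k ω) ω) atTop (nhds (y ω)) := fun ω =>
    tendsto_pi_nhds.2 fun i => hy i (Finset.mem_univ i) ω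
  exact ⟨ν, y, hν, hνk, measurable_of_tendsto_metrizable (fun k => measurable_select hu (hν k))
    (tendsto_pi_nhds.2 hlim), hlim⟩

end Selection

/-! ### Embedding real random scalars into `L⁰(𝓕, 𝕂)`. -/

section Hom

variable {Ω : Type*} [MeasurableSpace Ω] {P : Measure Ω} (𝕂 : Type*) [RCLike 𝕂]

theorem coeFn_ofRealL0 (ξ : Ω →ₘ[P] ℝ) : ofRealL0 𝕂 ξ =ᵐ[P] fun ω => ((ξ ω : ℝ) : 𝕂) :=
  AEEqFun.coeFn_comp _ _ _

theorem coeFn_indL0 {A : Set Ω} (hA : MeasurableSet A) :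
    indL0 P 𝕂 A hA =ᵐ[P] A.indicator fun _ => (1 : 𝕂) :=
  AEEqFun.coeFn_mk _ _

/-- The inclusion `L⁰(𝓕, ℝ) ⊆ L⁰(𝓕, 𝕂)` as an additive homomorphism. -/
def ofRealL0Hom : (Ω →ₘ[P] ℝ) →+ (Ω →ₘ[P] 𝕂) where
  toFun := ofRealL0 𝕂
  map_zero' := by
    refine AEEqFun.ext ?_
    filter_upwards [coeFn_ofRealL0 𝕂 (0 : Ω →ₘ[P] ℝ), AEEqFun.coeFn_zero (α := Ω) (β := ℝ) (μ := P),
      AEEqFun.coeFn_zero (α := Ω) (β := 𝕂) (μ := P)] with ω h1 h2 h3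
    rw [h1, h2, h3]
    simp
  map_add' ξ η := by
    refine AEEqFun.ext ?_
    filter_upwards [coeFn_ofRealL0 𝕂 ξ, coeFn_ofRealL0 𝕂 η, coeFn_ofRealL0 𝕂 (ξ + η),
      AEEqFun.coeFn_add ξ η, AEEqFun.coeFn_add (ofRealL0 𝕂 ξ) (ofRealL0 𝕂 η)] with ω h1 h2 h3 h4 h5
    rw [h3, h4, h5, Pi.add_apply, Pi.add_apply, h1, h2]
    simp

@[simp]
theorem ofRealL0Hom_apply (ξ : Ω →ₘ[P] ℝ) : ofRealL0Hom 𝕂 ξ = ofRealL0 𝕂 ξ := rfl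

theorem ofRealL0_injective : Function.Injective (ofRealL0 𝕂 : (Ω →ₘ[P] ℝ) → (Ω →ₘ[P] 𝕂)) := by
  intro ξ η h
  refine AEEqFun.ext ?_
  filter_upwards [coeFn_ofRealL0 𝕂 ξ, coeFn_ofRealL0 𝕂 η] with ω h1 h2
  rw [h, h2] at h1
  exact (RCLike.ofReal_injective h1).symm

end Hom

/-! ### Almost sure calculus of the `L⁰`-norm and convergence in probability. -/

section Norm

variable {Ω : Type*} [MeasurableSpace Ω] {P : Measure Ω} {𝕂 : Type*} [RCLike 𝕂]
  {E : Type*} [AddCommGroup E] [Module (Ω →ₘ[P] 𝕂) E] [RNModule P 𝕂 E]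

theorem coeFn_rnorm_smul (ξ : Ω →ₘ[P] 𝕂) (x : E) :
    (RNModule.rnorm 𝕂 (ξ • x) : Ω →ₘ[P] ℝ) =ᵐ[P]
      fun ω => ‖ξ ω‖ * (RNModule.rnorm 𝕂 x : Ω →ₘ[P] ℝ) ω := by
  rw [RNModule.rnorm_smul]
  filter_upwards [AEEqFun.coeFn_mul (absL0 ξ) (RNModule.rnorm 𝕂 x : Ω →ₘ[P] ℝ),
    (AEEqFun.coeFn_comp (fun z : 𝕂 => ‖z‖) continuous_norm ξ : absL0 ξ =ᵐ[P] _)] with ω h1 h2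
  refine h1.trans ?_
  rw [Pi.mul_apply, show absL0 ξ ω = ‖ξ ω‖ from h2]

theorem ae_rnorm_nonneg (x : E) : ∀ᵐ ω ∂P, 0 ≤ (RNModule.rnorm 𝕂 x : Ω →ₘ[P] ℝ) ω := by
  have h := AEEqFun.coeFn_le.2 (RNModule.rnorm_nonneg (P := P) (𝕂 := 𝕂) x)
  filter_upwards [h, AEEqFun.coeFn_zero (α := Ω) (β := ℝ) (μ := P)] with ω h1 h2
  have h3 : (0 : Ω →ₘ[P] ℝ) ω ≤ _ := h1
  rwa [h2] at h3

theorem ae_rnorm_zero : ∀ᵐ ω ∂P, (RNModule.rnorm 𝕂 (0 : E) : Ω →ₘ[P] ℝ) ω = 0 := by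
  have h := coeFn_rnorm_smul (P := P) (0 : Ω →ₘ[P] 𝕂) (0 : E)
  rw [smul_zero] at h
  filter_upwards [h, AEEqFun.coeFn_zero (α := Ω) (β := 𝕂) (μ := P)] with ω h1 h2
  rw [h1, show (0 : Ω →ₘ[P] 𝕂) ω = 0 from h2]
  simp

theorem ae_rnorm_add_le (x y : E) : ∀ᵐ ω ∂P, (RNModule.rnorm 𝕂 (x + y) : Ω →ₘ[P] ℝ) ω ≤
    (RNModule.rnorm 𝕂 x : Ω →ₘ[P] ℝ) ω + (RNModule.rnorm 𝕂 y : Ω →ₘ[P] ℝ) ω := by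
  have h := AEEqFun.coeFn_le.2 (RNModule.rnorm_add_le (P := P) (𝕂 := 𝕂) x y)
  filter_upwards [h, AEEqFun.coeFn_add (RNModule.rnorm 𝕂 x : Ω →ₘ[P] ℝ) (RNModule.rnorm 𝕂 y)]
    with ω h1 h2
  exact h1.trans_eq h2

theorem ae_rnorm_sum_le {ι : Type*} (s : Finset ι) (x : ι → E) :
    ∀ᵐ ω ∂P, (RNModule.rnorm 𝕂 (∑ i ∈ s, x i) : Ω →ₘ[P] ℝ) ω ≤
      ∑ i ∈ s, (RNModule.rnorm 𝕂 (x i) : Ω →ₘ[P] ℝ) ω := by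
  classical
  induction s using Finset.induction_on with
  | empty =>
    filter_upwards [ae_rnorm_zero (P := P) (𝕂 := 𝕂) (E := E)] with ω h
    simp [h]
  | insert i s hi ih =>
    filter_upwards [ih, ae_rnorm_add_le (P := P) (𝕂 := 𝕂) (x i) (∑ i ∈ s, x i)] with ω h1 h2
    rw [Finset.sum_insert hi, Finset.sum_insert hi]
    linarith

theorem eq_of_ae_rnorm_sub_eq_zero {x y : E}
    (h : ∀ᵐ ω ∂P, (RNModule.rnorm 𝕂 (x - y) : Ω →ₘ[P] ℝ) ω = 0) : x = y := by
  refine sub_eq_zero.1 (RNModule.eq_zero_of_rnorm (P := P) (𝕂 := 𝕂) _ (AEEqFun.ext ?_))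
  filter_upwards [h, AEEqFun.coeFn_zero (α := Ω) (β := ℝ) (μ := P)] with ω h1 h2
  rw [h1]
  exact h2.symm

/-- The `L⁰`-norm is local. -/
theorem ae_rnorm_eq_of_indL0_smul_eq {A : Set Ω} (hA : MeasurableSet A) {x y : E}
    (h : indL0 P 𝕂 A hA • x = indL0 P 𝕂 A hA • y) :
    ∀ᵐ ω ∂P, ω ∈ A → (RNModule.rnorm 𝕂 x : Ω →ₘ[P] ℝ) ω = (RNModule.rnorm 𝕂 y : Ω →ₘ[P] ℝ) ω := by
  have hx := coeFn_rnorm_smul (indL0 P 𝕂 A hA) x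
  rw [h] at hx
  filter_upwards [hx, coeFn_rnorm_smul (indL0 P 𝕂 A hA) y, coeFn_indL0 (P := P) 𝕂 hA]
    with ω h1 h2 h3 hω
  rw [h1, h3, Set.indicator_of_mem hω] at h2
  simpa using h2

theorem IsConcatenation.unique {A : CountablePartition Ω} {x : ℕ → E} {y z : E}
    (hy : IsConcatenation P 𝕂 A x y) (hz : IsConcatenation P 𝕂 A x z) : y = z := by
  refine eq_of_ae_rnorm_sub_eq_zero (P := P) (𝕂 := 𝕂) ?_
  have h : ∀ l, ∀ᵐ ω ∂P, ω ∈ A.piece l → (RNModule.rnorm 𝕂 (y - z) : Ω →ₘ[P] ℝ) ω = _ := fun l =>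
    ae_rnorm_eq_of_indL0_smul_eq (P := P) (𝕂 := 𝕂) (x := y - z) (y := 0)
      (A.measurableSet_piece l) (by rw [smul_sub, hy l, hz l, sub_self, smul_zero])
  filter_upwards [ae_all_iff.2 h, ae_rnorm_zero (P := P) (𝕂 := 𝕂) (E := E)] with ω h1 h2
  obtain ⟨l, hl⟩ := Set.mem_iUnion.1 (A.iUnion_piece ▸ Set.mem_univ ω)
  rw [h1 l hl, h2]

variable [IsProbabilityMeasure P]

/-- Convergence in the `(ε, λ)`-topology is convergence of the `L⁰`-norms in probability. -/
theorem tendstoEpsLambda_iff (x : ℕ → E) (a : E) : TendstoEpsLambda P 𝕂 x a ↔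
    TendstoInMeasure P (fun k => ((RNModule.rnorm 𝕂 (x k - a) : Ω →ₘ[P] ℝ) : Ω → ℝ)) atTop
      (fun _ => (0 : ℝ)) := by
  rw [tendstoInMeasure_iff_measureReal_norm]
  have hset : ∀ k (ε : ℝ), P.real {ω | (RNModule.rnorm 𝕂 (x k - a) : Ω →ₘ[P] ℝ) ω < ε} =
      1 - P.real {ω | ε ≤ ‖(RNModule.rnorm 𝕂 (x k - a) : Ω →ₘ[P] ℝ) ω - 0‖} := by
    intro k ε
    have hm : MeasurableSet {ω | (RNModule.rnorm 𝕂 (x k - a) : Ω →ₘ[P] ℝ) ω < ε} :=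
      measurableSet_lt (AEEqFun.measurable _) measurable_const
    have h1 := probReal_compl_eq_one_sub (μ := P) hm
    have h2 : P.real {ω | ε ≤ ‖(RNModule.rnorm 𝕂 (x k - a) : Ω →ₘ[P] ℝ) ω - 0‖} =
        P.real {ω | (RNModule.rnorm 𝕂 (x k - a) : Ω →ₘ[P] ℝ) ω < ε}ᶜ := by
      refine measureReal_congr ?_
      filter_upwards [ae_rnorm_nonneg (P := P) (𝕂 := 𝕂) (x k - a)] with ω hω
      refine propext ?_
      change ε ≤ ‖_‖ ↔ ¬ (_ < ε)
      rw [sub_zero, Real.norm_of_nonneg hω, not_lt]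
    rw [h2, h1]
    ring
  constructor
  · intro h ε hε
    rw [Metric.tendsto_atTop']
    intro δ hδ
    obtain ⟨N, hN⟩ := eventually_atTop.1
      (h ε (min δ (1 / 2)) hε (by positivity) (lt_of_le_of_lt (min_le_right _ _) (by norm_num)))
    refine ⟨N, fun k hk => ?_⟩
    have h1 : 1 - min δ (1 / 2) < P.real _ := hN k hk.le
    rw [hset] at h1
    rw [Real.dist_eq, sub_zero, abs_of_nonneg measureReal_nonneg]
    linarith [min_le_left δ (1 / 2)]
  · intro h ε δ hε hδ _
    filter_upwards [(h ε hε).eventually_lt_const hδ] with k hk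
    change 1 - δ < P.real _
    rw [hset]
    linarith

end Norm

/-! ### Random barycentric coordinates, required to lie in the simplex at every ω. -/

/-- A random point of the standard simplex. -/
structure RandomPoint (Ω : Type*) [MeasurableSpace Ω] (n : ℕ) where
  coord : Ω → Fin n → ℝ
  measurable_coord : Measurable coord
  coord_mem : ∀ ω, coord ω ∈ stdSimplex ℝ (Fin n)

namespace RandomPoint

variable {Ω : Type*} [MeasurableSpace Ω] {n : ℕ}

theorem measurable_coord_apply (g : RandomPoint Ω n) (i : Fin n) :
    Measurable fun ω => g.coord ω i :=
  (measurable_pi_apply i).comp g.measurable_coord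

theorem abs_coord_le_one (g : RandomPoint Ω n) (ω : Ω) (i : Fin n) : |g.coord ω i| ≤ 1 := by
  obtain ⟨h0, h1⟩ := g.coord_mem ω
  rw [abs_of_nonneg (h0 i), ← h1]
  exact Finset.single_le_sum (fun j _ => h0 j) (Finset.mem_univ i)

/-- The random point which equals `g l` on the event `ν = l`. -/
def select (g : ℕ → RandomPoint Ω n) (ν : Ω → ℕ) (hν : Measurable ν) : RandomPoint Ω n where
  coord ω := (g (ν ω)).coord ω
  measurable_coord := measurable_select (fun m => (g m).measurable_coord) hν
  coord_mem ω := (g (ν ω)).coord_mem ω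

/-- The class of the `i`-th coordinate of a random point. -/
def coordL0 (P : Measure Ω) (g : RandomPoint Ω n) (i : Fin n) : Ω →ₘ[P] ℝ :=
  AEEqFun.mk (fun ω => g.coord ω i) (g.measurable_coord_apply i).aestronglyMeasurable

theorem coeFn_coordL0 (P : Measure Ω) (g : RandomPoint Ω n) (i : Fin n) :
    g.coordL0 P i =ᵐ[P] fun ω => g.coord ω i :=
  AEEqFun.coeFn_mk _ _

theorem coordL0_nonneg (P : Measure Ω) (g : RandomPoint Ω n) (i : Fin n) :
    0 ≤ g.coordL0 P i := by
  rw [← AEEqFun.coeFn_le]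
  filter_upwards [g.coeFn_coordL0 P i, AEEqFun.coeFn_zero (α := Ω) (β := ℝ) (μ := P)] with ω h1 h2
  rw [h1, h2]
  exact (g.coord_mem ω).1 i

theorem sum_coordL0 (P : Measure Ω) (g : RandomPoint Ω n) : ∑ i, g.coordL0 P i = 1 := by
  refine AEEqFun.ext ?_
  filter_upwards [AEEqFun.coeFn_finsetSum Finset.univ (g.coordL0 P),
    ae_all_iff.2 (g.coeFn_coordL0 P), AEEqFun.coeFn_one (α := Ω) (β := ℝ) (μ := P)] with ω h1 h2 h3
  refine h1.trans ?_
  rw [show (1 : Ω →ₘ[P] ℝ) ω = 1 from h3]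
  rw [Finset.sum_apply]
  simp only [h2]
  exact (g.coord_mem ω).2

theorem exists_coordL0_eq [NeZero n] (P : Measure Ω) {ξ : Fin n → Ω →ₘ[P] ℝ} (h0 : ∀ i, 0 ≤ ξ i)
    (h1 : ∑ i, ξ i = 1) : ∃ g : RandomPoint Ω n, ∀ i, g.coordL0 P i = ξ i := by
  classical
  set A : Set Ω := {ω | (fun i => ξ i ω) ∈ stdSimplex ℝ (Fin n)} with hA
  have hm : Measurable fun ω i => ξ i ω := measurable_pi_lambda _ fun i => AEEqFun.measurable _
  have hAm : MeasurableSet A := hm (isClosed_stdSimplex ℝ (Fin n)).measurableSet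
  -- Representatives lie in the simplex only almost surely; a vertex is substituted on the
  -- exceptional null set.
  refine ⟨⟨A.piecewise (fun ω i => ξ i ω) fun _ => Pi.single 0 1,
    hm.piecewise hAm measurable_const, fun ω => ?_⟩, fun i => AEEqFun.ext ?_⟩
  · by_cases hω : ω ∈ A
    · rw [Set.piecewise_eq_of_mem _ _ _ hω]
      exact hω
    · rw [Set.piecewise_eq_of_notMem _ _ _ hω]
      exact single_mem_stdSimplex ℝ 0
  · refine (coeFn_coordL0 P _ i).trans ?_
    have h0' : ∀ i, ∀ᵐ ω ∂P, 0 ≤ ξ i ω := fun i => by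
      filter_upwards [AEEqFun.coeFn_le.2 (h0 i), AEEqFun.coeFn_zero (α := Ω) (β := ℝ) (μ := P)]
        with ω h2 h3
      rw [h3] at h2
      exact h2
    have h2 := AEEqFun.coeFn_finsetSum Finset.univ ξ
    have h3 : (∑ i, ξ i : Ω →ₘ[P] ℝ) =ᵐ[P] fun _ => (1 : ℝ) := by
      rw [h1]
      exact AEEqFun.coeFn_one
    filter_upwards [ae_all_iff.2 h0', h2, h3] with ω h4 h5 h6
    have hω : ω ∈ A := ⟨h4, (Finset.sum_apply ω Finset.univ _).symm.trans (h5.symm.trans h6)⟩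
    simp only [Set.piecewise_eq_of_mem _ _ _ hω]

end RandomPoint

/-! ### Points of the `L⁰`-simplex in coordinates. -/

section Comb

variable {Ω : Type*} [MeasurableSpace Ω] (P : Measure Ω) (𝕂 : Type*) [RCLike 𝕂]
  {E : Type*} [AddCommGroup E] [Module (Ω →ₘ[P] 𝕂) E] {n : ℕ}

/-- The point of the `L⁰`-simplex with the given random barycentric coordinates. -/
def comb (x : Fin n → E) (g : RandomPoint Ω n) : E :=
  ∑ i, ofRealL0 𝕂 (g.coordL0 P i) • x i

theorem comb_mem (x : Fin n → E) (g : RandomPoint Ω n) :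
    comb P 𝕂 x g ∈ convL0 P 𝕂 (Set.range x) :=
  ⟨n, x, g.coordL0 P, fun i => Set.mem_range_self i, g.coordL0_nonneg P, g.sum_coordL0 P, rfl⟩

/-- A convex combination in `convL0` may repeat vertices, so the weights are collected over the
fibres of the vertex labelling `a`. -/
theorem exists_comb_eq [NeZero n] {x : Fin n → E} {y : E} (hy : y ∈ convL0 P 𝕂 (Set.range x)) :
    ∃ g : RandomPoint Ω n, comb P 𝕂 x g = y := by
  classical
  obtain ⟨m, z, ξ, hz, h0, h1, rfl⟩ := hy
  choose a ha using hz
  obtain ⟨g, hg⟩ := RandomPoint.exists_coordL0_eq P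
    (ξ := fun j => ∑ i with a i = j, ξ i) (fun j => by
      rw [← AEEqFun.coeFn_le]
      have h0' : ∀ i, ∀ᵐ ω ∂P, 0 ≤ ξ i ω := fun i => by
        filter_upwards [AEEqFun.coeFn_le.2 (h0 i), AEEqFun.coeFn_zero (α := Ω) (β := ℝ) (μ := P)]
          with ω h2 h3
        rw [h3] at h2
        exact h2
      filter_upwards [ae_all_iff.2 h0', AEEqFun.coeFn_zero (α := Ω) (β := ℝ) (μ := P),
        AEEqFun.coeFn_finsetSum (Finset.univ.filter fun i => a i = j) ξ] with ω h2 h3 h4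
      rw [h3, h4, Finset.sum_apply]
      exact Finset.sum_nonneg fun i _ => h2 i)
    (by rw [Finset.sum_fiberwise, h1])
  refine ⟨g, ?_⟩
  unfold comb
  rw [← Finset.sum_fiberwise (s := Finset.univ) a]
  refine Finset.sum_congr rfl fun j _ => ?_
  rw [hg, ← ofRealL0Hom_apply, map_sum, Finset.sum_smul]
  refine Finset.sum_congr rfl fun i hi => ?_
  rw [← ha i, (Finset.mem_filter.1 hi).2, ofRealL0Hom_apply]

variable {P 𝕂}

theorem comb_congr_ae (x : Fin n → E) {g h : RandomPoint Ω n}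
    (hgh : ∀ᵐ ω ∂P, g.coord ω = h.coord ω) : comb P 𝕂 x g = comb P 𝕂 x h := by
  refine Finset.sum_congr rfl fun i _ => ?_
  have : g.coordL0 P i = h.coordL0 P i := by
    refine AEEqFun.mk_eq_mk.2 ?_
    filter_upwards [hgh] with ω hω
    rw [hω]
  rw [this]

/-- The coefficient differences sum to zero, so subtracting `x 0` from every vertex turns their
vanishing combination into a linear relation among the `x i - x 0`. -/
theorem AffineIndependentL0.ae_coord_eq [NeZero n] {x : Fin n → E}
    (hx : AffineIndependentL0 P 𝕂 x) {g h : RandomPoint Ω n}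
    (hgh : comb P 𝕂 x g = comb P 𝕂 x h) : ∀ᵐ ω ∂P, g.coord ω = h.coord ω := by
  classical
  set c : Fin n → Ω →ₘ[P] 𝕂 :=
    fun i => ofRealL0 𝕂 (g.coordL0 P i) - ofRealL0 𝕂 (h.coordL0 P i) with hc
  have hsum : ∑ i, c i = 0 := by
    have h1 : ∀ g : RandomPoint Ω n, ∑ i, ofRealL0 𝕂 (g.coordL0 P i) = ofRealL0 𝕂 1 := fun g => by
      rw [← g.sum_coordL0 P, ← ofRealL0Hom_apply, map_sum]
      rfl
    rw [hc, Finset.sum_sub_distrib, h1, h1, sub_self]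
  have hcx : ∑ i, c i • x i = 0 := by
    simp only [hc, sub_smul, Finset.sum_sub_distrib]
    exact sub_eq_zero.2 hgh
  have hcd : ∑ i : {i : Fin n // i ≠ 0}, c i • (x i - x 0) = 0 := by
    rw [← Finset.sum_subtype (Finset.univ.erase 0) (p := fun i => i ≠ 0) (by simp)
      fun i => c i • (x i - x 0), Finset.sum_erase _ (by rw [sub_self, smul_zero])]
    simp only [smul_sub, Finset.sum_sub_distrib, hcx, ← Finset.sum_smul, hsum, zero_smul, sub_zero]
  have hzero : ∀ i, i ≠ 0 → c i = 0 := fun i hi =>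
    Fintype.linearIndependent_iff.1 hx (fun i => c i) hcd ⟨i, hi⟩
  have hzero' : ∀ i, c i = 0 := fun i => by
    by_cases hi : i = 0
    · subst hi
      rw [← Finset.add_sum_erase _ _ (Finset.mem_univ (0 : Fin n)),
        Finset.sum_eq_zero fun i hi => hzero i (Finset.ne_of_mem_erase hi), add_zero] at hsum
      exact hsum
    · exact hzero i hi
  have hae : ∀ i, ∀ᵐ ω ∂P, g.coord ω i = h.coord ω i := fun i => by
    have := ofRealL0_injective 𝕂 (sub_eq_zero.1 (hzero' i))
    exact AEEqFun.mk_eq_mk.1 this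
  filter_upwards [ae_all_iff.2 hae] with ω hω
  exact funext hω

theorem indL0_smul_comb_congr (x : Fin n → E) {A : Set Ω} (hA : MeasurableSet A)
    {g h : RandomPoint Ω n} (hgh : ∀ ω ∈ A, g.coord ω = h.coord ω) :
    indL0 P 𝕂 A hA • comb P 𝕂 x g = indL0 P 𝕂 A hA • comb P 𝕂 x h := by
  unfold comb
  rw [Finset.smul_sum, Finset.smul_sum]
  refine Finset.sum_congr rfl fun i _ => ?_
  rw [smul_smul, smul_smul]
  congr 1
  refine AEEqFun.ext ?_
  filter_upwards [AEEqFun.coeFn_mul (indL0 P 𝕂 A hA) (ofRealL0 𝕂 (g.coordL0 P i)),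
    AEEqFun.coeFn_mul (indL0 P 𝕂 A hA) (ofRealL0 𝕂 (h.coordL0 P i)), coeFn_indL0 (P := P) 𝕂 hA,
    coeFn_ofRealL0 𝕂 (g.coordL0 P i), coeFn_ofRealL0 𝕂 (h.coordL0 P i), g.coeFn_coordL0 P i,
    h.coeFn_coordL0 P i] with ω h1 h2 h3 h4 h5 h6 h7
  refine h1.trans (Eq.trans ?_ h2.symm)
  rw [Pi.mul_apply, Pi.mul_apply, h3, h4, h5, h6, h7]
  by_cases hω : ω ∈ A
  · rw [hgh ω hω]
  · simp [hω]

/-- The partition of `Ω` into the events `ν = l`. -/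
def fiberPartition (ν : Ω → ℕ) (hν : Measurable ν) : CountablePartition Ω where
  piece l := {ω | ν ω = l}
  measurableSet_piece l := hν (measurableSet_singleton l)
  disjoint_piece i j hij := Set.disjoint_left.2 fun ω (hi : ν ω = i) (hj : ν ω = j) =>
    hij (hi.symm.trans hj)
  iUnion_piece := Set.eq_univ_of_forall fun ω => Set.mem_iUnion.2 ⟨ν ω, rfl⟩

theorem isConcatenation_comb_select (x : Fin n → E) (g : ℕ → RandomPoint Ω n) {ν : Ω → ℕ}
    (hν : Measurable ν) : IsConcatenation P 𝕂 (fiberPartition ν hν) (fun l => comb P 𝕂 x (g l))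
      (comb P 𝕂 x (RandomPoint.select g ν hν)) := fun l =>
  indL0_smul_comb_congr x _ fun ω (hω : ν ω = l) => by simp only [RandomPoint.select, hω]

variable [RNModule P 𝕂 E]

theorem ae_rnorm_comb_sub_le (x : Fin n → E) (g h : RandomPoint Ω n) :
    ∀ᵐ ω ∂P, (RNModule.rnorm 𝕂 (comb P 𝕂 x g - comb P 𝕂 x h) : Ω →ₘ[P] ℝ) ω ≤
      ∑ i, |g.coord ω i - h.coord ω i| * (RNModule.rnorm 𝕂 (x i) : Ω →ₘ[P] ℝ) ω := by
  have h1 : comb P 𝕂 x g - comb P 𝕂 x h =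
      ∑ i, (ofRealL0 𝕂 (g.coordL0 P i) - ofRealL0 𝕂 (h.coordL0 P i)) • x i := by
    simp only [comb, sub_smul, Finset.sum_sub_distrib]
  rw [h1]
  have h2 := fun i => coeFn_rnorm_smul
    (ofRealL0 𝕂 (g.coordL0 P i) - ofRealL0 𝕂 (h.coordL0 P i)) (x i)
  have h3 := fun i => AEEqFun.coeFn_sub (ofRealL0 𝕂 (g.coordL0 P i)) (ofRealL0 𝕂 (h.coordL0 P i))
  filter_upwards [ae_rnorm_sum_le (P := P) (𝕂 := 𝕂) Finset.univ
      fun i => (ofRealL0 𝕂 (g.coordL0 P i) - ofRealL0 𝕂 (h.coordL0 P i)) • x i,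
    ae_all_iff.2 h2, ae_all_iff.2 h3, ae_all_iff.2 fun i => coeFn_ofRealL0 𝕂 (g.coordL0 P i),
    ae_all_iff.2 fun i => coeFn_ofRealL0 𝕂 (h.coordL0 P i), ae_all_iff.2 (g.coeFn_coordL0 P),
    ae_all_iff.2 (h.coeFn_coordL0 P)] with ω k1 k2 k3 k4 k5 k6 k7
  refine k1.trans (Finset.sum_le_sum fun i _ => le_of_eq ?_)
  rw [k2, show (ofRealL0 𝕂 (g.coordL0 P i) - ofRealL0 𝕂 (h.coordL0 P i) : Ω →ₘ[P] 𝕂) ω = _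
    from k3 i, Pi.sub_apply, k4, k5, k6, k7, ← RCLike.ofReal_sub, RCLike.norm_ofReal]

theorem ae_tendsto_rnorm_comb_sub (x : Fin n → E) {g : ℕ → RandomPoint Ω n} {h : RandomPoint Ω n}
    (hgh : ∀ᵐ ω ∂P, Tendsto (fun k => (g k).coord ω) atTop (nhds (h.coord ω))) :
    ∀ᵐ ω ∂P, Tendsto (fun k => (RNModule.rnorm 𝕂 (comb P 𝕂 x (g k) - comb P 𝕂 x h) : Ω →ₘ[P] ℝ) ω)
      atTop (nhds 0) := by
  filter_upwards [hgh, ae_all_iff.2 fun k => ae_rnorm_comb_sub_le (P := P) (𝕂 := 𝕂) x (g k) h,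
    ae_all_iff.2 fun k =>
      ae_rnorm_nonneg (P := P) (𝕂 := 𝕂) (comb P 𝕂 x (g k) - comb P 𝕂 x h)] with ω h1 h2 h3
  refine squeeze_zero h3 h2 ?_
  rw [show (0 : ℝ) = ∑ i, |h.coord ω i - h.coord ω i| * (RNModule.rnorm 𝕂 (x i) : Ω →ₘ[P] ℝ) ω
    by simp]
  exact tendsto_finsetSum _ fun i _ =>
    (((tendsto_pi_nhds.1 h1 i).sub_const _).abs).mul_const _

theorem tendstoEpsLambda_comb [IsProbabilityMeasure P] (x : Fin n → E) {g : ℕ → RandomPoint Ω n}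
    {h : RandomPoint Ω n}
    (hgh : ∀ᵐ ω ∂P, Tendsto (fun k => (g k).coord ω) atTop (nhds (h.coord ω))) :
    TendstoEpsLambda P 𝕂 (fun k => comb P 𝕂 x (g k)) (comb P 𝕂 x h) :=
  (tendstoEpsLambda_iff _ _).2 <| tendstoInMeasure_of_tendsto_ae
    (fun _ => AEEqFun.aestronglyMeasurable _) (ae_tendsto_rnorm_comb_sub x hgh)

end Comb

/-! ### Approximate fixed points and passage to the limit. -/

section FixedPoint

variable {Ω : Type*} [MeasurableSpace Ω] {P : Measure Ω} {𝕂 : Type*} [RCLike 𝕂]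
  {E : Type*} [AddCommGroup E] [Module (Ω →ₘ[P] 𝕂) E] [RNModule P 𝕂 E] {n : ℕ}

theorem ae_rnorm_sub_rev (x y : E) : ∀ᵐ ω ∂P,
    (RNModule.rnorm 𝕂 (x - y) : Ω →ₘ[P] ℝ) ω = (RNModule.rnorm 𝕂 (y - x) : Ω →ₘ[P] ℝ) ω := by
  have h := coeFn_rnorm_smul (P := P) (-1 : Ω →ₘ[P] 𝕂) (y - x)
  rw [neg_smul, one_smul, neg_sub] at h
  filter_upwards [h, AEEqFun.coeFn_neg (1 : Ω →ₘ[P] 𝕂), AEEqFun.coeFn_one (α := Ω) (β := 𝕂) (μ := P)]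
    with ω h1 h2 h3
  rw [h1, show (-1 : Ω →ₘ[P] 𝕂) ω = -1 from h2.trans (by rw [Pi.neg_apply, h3, Pi.one_apply])]
  simp

/-- A random subsequence of an almost surely convergent sequence of simplex points converges to the
same limit. -/
theorem comb_eq_of_tendsto_select (x : Fin n → E) {g : ℕ → RandomPoint Ω n}
    {b h : RandomPoint Ω n}
    (hg : ∀ᵐ ω ∂P, Tendsto
      (fun k => (RNModule.rnorm 𝕂 (comb P 𝕂 x (g k) - comb P 𝕂 x h) : Ω →ₘ[P] ℝ) ω) atTop (nhds 0))
    {ρ : ℕ → Ω → ℕ} (hρ : ∀ k, Measurable (ρ k)) (hρk : ∀ k ω, k ≤ ρ k ω)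
    (hb : ∀ ω, Tendsto (fun k => (g (ρ k ω)).coord ω) atTop (nhds (b.coord ω))) :
    comb P 𝕂 x b = comb P 𝕂 x h := by
  refine eq_of_ae_rnorm_sub_eq_zero (P := P) (𝕂 := 𝕂) ?_
  set c : ℕ → E := fun k => comb P 𝕂 x (RandomPoint.select g (ρ k) (hρ k)) with hc
  have h1 : ∀ᵐ ω ∂P, Tendsto
      (fun k => (RNModule.rnorm 𝕂 (c k - comb P 𝕂 x b) : Ω →ₘ[P] ℝ) ω) atTop (nhds 0) :=
    ae_tendsto_rnorm_comb_sub x (Eventually.of_forall hb)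
  -- By locality of the norm, on the event `ρ k = l` the selected point may be replaced by `g l`.
  have h2 : ∀ k l, ∀ᵐ ω ∂P, ρ k ω = l →
      (RNModule.rnorm 𝕂 (c k - comb P 𝕂 x h) : Ω →ₘ[P] ℝ) ω =
        (RNModule.rnorm 𝕂 (comb P 𝕂 x (g l) - comb P 𝕂 x h) : Ω →ₘ[P] ℝ) ω := fun k l =>
    ae_rnorm_eq_of_indL0_smul_eq ((fiberPartition (ρ k) (hρ k)).measurableSet_piece l) (by
      rw [smul_sub, smul_sub, isConcatenation_comb_select x g (hρ k) l])
  filter_upwards [hg, h1, ae_all_iff.2 fun k => ae_all_iff.2 (h2 k),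
    ae_all_iff.2 fun k => ae_rnorm_sub_rev (P := P) (𝕂 := 𝕂) (comb P 𝕂 x b) (c k),
    ae_all_iff.2 fun k =>
      ae_rnorm_add_le (P := P) (𝕂 := 𝕂) (comb P 𝕂 x b - c k) (c k - comb P 𝕂 x h),
    ae_rnorm_nonneg (P := P) (𝕂 := 𝕂) (comb P 𝕂 x b - comb P 𝕂 x h)] with ω k1 k2 k3 k4 k5 k6
  have h3 : Tendsto (fun k => (RNModule.rnorm 𝕂 (c k - comb P 𝕂 x h) : Ω →ₘ[P] ℝ) ω) atTop
      (nhds 0) := by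
    simp only [fun k => k3 k _ rfl]
    exact k1.comp (tendsto_atTop_mono (fun k => hρk k ω) tendsto_id)
  refine le_antisymm (ge_of_tendsto' (by simpa using k2.add h3) fun k => ?_) k6
  have := k5 k
  rwa [sub_add_sub_cancel, k4 k] at this

/-- The point of the `L⁰`-simplex with the given random barycentric coordinates, as an element of
the simplex. -/
def simplexPoint (P : Measure Ω) (𝕂 : Type*) [RCLike 𝕂] [Module (Ω →ₘ[P] 𝕂) E] (x : Fin n → E)
    (g : RandomPoint Ω n) : convL0 P 𝕂 (Set.range x) :=
  ⟨comb P 𝕂 x g, comb_mem P 𝕂 x g⟩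

variable {x : Fin n → E} {f : convL0 P 𝕂 (Set.range x) → convL0 P 𝕂 (Set.range x)}

/-- This replaces pointwise evaluation of `f`: images of measurable selections follow from the
images of the selected sequence, as concatenations are unique. -/
theorem SigmaStableMap.apply_simplexPoint_select (hf : SigmaStableMap P 𝕂 f)
    {g h : ℕ → RandomPoint Ω n}
    (hgh : ∀ l, f (simplexPoint P 𝕂 x (g l)) = simplexPoint P 𝕂 x (h l)) {ν : Ω → ℕ}
    (hν : Measurable ν) : f (simplexPoint P 𝕂 x (RandomPoint.select g ν hν)) =
      simplexPoint P 𝕂 x (RandomPoint.select h ν hν) := by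
  have h1 := hf (fiberPartition ν hν) (fun l => simplexPoint P 𝕂 x (g l))
    (simplexPoint P 𝕂 x (RandomPoint.select g ν hν)) (isConcatenation_comb_select x g hν)
  simp only [hgh] at h1
  exact Subtype.ext (h1.unique (isConcatenation_comb_select x h hν))

/-- Along a pointwise convergent sequence of random points, almost surely a subsequence of the
coordinates of the images converges to the coordinates of the image of the limit. -/
theorem RandomSeqContinuous.ae_exists_tendsto_coord [IsProbabilityMeasure P] [NeZero n]
    (hx : AffineIndependentL0 P 𝕂 x) (hs : SigmaStableMap P 𝕂 f) (hf : RandomSeqContinuous P 𝕂 f)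
    {g h : ℕ → RandomPoint Ω n} {y z : RandomPoint Ω n}
    (hgh : ∀ k, f (simplexPoint P 𝕂 x (g k)) = simplexPoint P 𝕂 x (h k))
    (hyz : f (simplexPoint P 𝕂 x y) = simplexPoint P 𝕂 x z)
    (hg : ∀ ω, Tendsto (fun k => (g k).coord ω) atTop (nhds (y.coord ω))) :
    ∀ᵐ ω ∂P, ∃ s : ℕ → ℕ, Tendsto s atTop atTop ∧
      Tendsto (fun k => (h (s k)).coord ω) atTop (nhds (z.coord ω)) := by
  obtain ⟨w, ⟨ν, hν, hνw⟩, hw⟩ := hf (simplexPoint P 𝕂 x y) (fun k => simplexPoint P 𝕂 x (g k))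
    (tendstoEpsLambda_comb x (Eventually.of_forall hg))
  have hνm : ∀ k, Measurable (ν k) := fun k => (ν k).stronglyMeasurable.measurable
  have hfw : ∀ k, (f (w k) : E) = comb P 𝕂 x (RandomPoint.select h (ν k) (hνm k)) := fun k => by
    have : w k = simplexPoint P 𝕂 x (RandomPoint.select g (ν k) (hνm k)) :=
      Subtype.ext ((hνw k).unique (isConcatenation_comb_select x g (hνm k)))
    rw [this, hs.apply_simplexPoint_select hgh (hνm k)]
    rfl
  simp only [hfw, hyz] at hw
  obtain ⟨ns, hns, hlim⟩ := ((tendstoEpsLambda_iff _ _).1 hw).exists_seq_tendsto_ae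
  set H : ℕ → RandomPoint Ω n := fun k => RandomPoint.select h (ν (ns k)) (hνm (ns k)) with hH
  -- Norm convergence gives no direct control of the coordinates. Compactness produces a random
  -- coordinate limit `b`; its combination has the same limit in norm, so affine independence gives
  -- `b = z` almost surely.
  obtain ⟨ρ, b, hρ, hρk, hb, hbl⟩ := exists_random_subsequence_tendsto
    (fun k => (H k).measurable_coord) (fun k ω i => (H k).abs_coord_le_one ω i)
  have hzb := hx.ae_coord_eq (comb_eq_of_tendsto_select x (b := ⟨b, hb, fun ω =>
    (isClosed_stdSimplex ℝ (Fin n)).mem_of_tendsto (hbl ω)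
      (Eventually.of_forall fun k => (H (ρ k ω)).coord_mem ω)⟩) hlim hρ hρk hbl)
  filter_upwards [hzb, ae_all_iff.2 hν] with ω h1 h2
  refine ⟨fun k => ν (ns (ρ k ω)) ω, ?_, ?_⟩
  · have hmono : StrictMono fun k => ν k ω := strictMono_nat_of_lt_succ h2
    exact hmono.tendsto_atTop.comp (hns.tendsto_atTop.comp
      (tendsto_atTop_mono (fun k => hρk k ω) tendsto_id))
  · rw [← h1]
    exact hbl ω

/-- Approximate random fixed points: nearby random points `G i` such that the `i`-th coordinate of
the image of `G i` is almost as large as that of `G i`. -/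
theorem SigmaStableMap.exists_approx [NeZero n] (hf : SigmaStableMap P 𝕂 f) (m : ℕ) :
    ∃ G H : Fin n → RandomPoint Ω n,
      (∀ i, f (simplexPoint P 𝕂 x (G i)) = simplexPoint P 𝕂 x (H i)) ∧
      (∀ ω i, (G i).coord ω i - n / ((m : ℝ) + 1) ≤ (H i).coord ω i) ∧
      ∀ ω i i' j, |(G i).coord ω j - (G i').coord ω j| ≤ n / ((m : ℝ) + 1) := by
  classical
  have hm : (0 : ℝ) < (m : ℝ) + 1 := by positivity
  have hg : ∀ v : Fin n → ℕ, ∃ g : RandomPoint Ω n, ∑ j, v j = m + 1 →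
      ∀ ω j, g.coord ω j = v j / ((m : ℝ) + 1) := by
    intro v
    by_cases hv : ∑ j, v j = m + 1
    · refine ⟨⟨fun _ j => v j / ((m : ℝ) + 1), measurable_const, fun _ => ⟨fun j => by positivity, ?_⟩⟩,
        fun _ _ _ => rfl⟩
      rw [← Finset.sum_div, ← Nat.cast_sum, hv]
      push_cast
      exact div_self hm.ne'
    -- A dummy vertex for tuples off the grid, which are never selected.
    · exact ⟨⟨fun _ => Pi.single 0 1, measurable_const, fun _ => single_mem_stdSimplex ℝ 0⟩,
        fun h => absurd h hv⟩
  choose g hg using hg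
  have hh : ∀ v, ∃ h : RandomPoint Ω n, f (simplexPoint P 𝕂 x (g v)) = simplexPoint P 𝕂 x h :=
    fun v => by
      obtain ⟨h, hh⟩ := exists_comb_eq P 𝕂 (f (simplexPoint P 𝕂 x (g v))).2
      exact ⟨h, Subtype.ext hh.symm⟩
  choose h hh using hh
  -- Enumerating all tuples of grid points lets the least admissible index serve as a measurable
  -- choice.
  obtain ⟨e, he⟩ := exists_surjective_nat (Fin n → Fin n → ℕ)
  have hex : ∀ ω, ∃ k, ((∀ i, ∑ j, e k i j = m + 1) ∧ ∀ i i' j, e k i j ≤ e k i' j + n) ∧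
      ∀ i, (g (e k i)).coord ω i - n / ((m : ℝ) + 1) ≤ (h (e k i)).coord ω i := by
    intro ω
    -- Two points of the simplex have equal coordinate sums, so some coordinate does not decrease.
    -- Its index is the colour of `v` at ω.
    have hc : ∀ v, ∃ i, (g v).coord ω i ≤ (h v).coord ω i := fun v => by
      obtain ⟨i, -, hi⟩ := Finset.exists_le_of_sum_le (s := Finset.univ) Finset.univ_nonempty
        (((g v).coord_mem ω).2.trans ((h v).coord_mem ω).2.symm).le
      exact ⟨i, hi⟩
    choose c hc using hc
    obtain ⟨v, hv1, hv2, hv3⟩ := exists_grid_points (m + 1) c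
    obtain ⟨k, rfl⟩ := he v
    refine ⟨k, ⟨hv1, hv3⟩, fun i => ?_⟩
    rcases hv2 i with hi | hi
    · have h1 := hc (e k i)
      rw [hi] at h1
      have h2 : (0 : ℝ) ≤ n / ((m : ℝ) + 1) := by positivity
      linarith
    · refine le_trans ?_ (((h (e k i)).coord_mem ω).1 i)
      rw [hg _ (hv1 i), sub_nonpos]
      gcongr
  set τ : Ω → ℕ := fun ω => Nat.find (hex ω) with hτ
  have hτm : Measurable τ := by
    refine measurable_find hex fun k => (MeasurableSet.const _).inter ?_
    change MeasurableSet {ω | ∀ i, (g (e k i)).coord ω i - n / ((m : ℝ) + 1) ≤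
      (h (e k i)).coord ω i}
    rw [Set.ofPred_forall]
    exact MeasurableSet.iInter fun i => measurableSet_le
      (((g (e k i)).measurable_coord_apply i).sub_const _) ((h (e k i)).measurable_coord_apply i)
  have hspec : ∀ ω, ((∀ i, ∑ j, e (τ ω) i j = m + 1) ∧
      ∀ i i' j, e (τ ω) i j ≤ e (τ ω) i' j + n) ∧
      ∀ i, (g (e (τ ω) i)).coord ω i - n / ((m : ℝ) + 1) ≤ (h (e (τ ω) i)).coord ω i :=
    fun ω => Nat.find_spec (hex ω)
  refine ⟨fun i => RandomPoint.select (fun k => g (e k i)) τ hτm,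
    fun i => RandomPoint.select (fun k => h (e k i)) τ hτm,
    fun i => hf.apply_simplexPoint_select (fun k => hh _) hτm, fun ω i => (hspec ω).2 i,
    fun ω i i' j => ?_⟩
  have h1 := fun i => hg _ ((hspec ω).1.1 i) ω j
  simp only [RandomPoint.select]
  rw [h1, h1, ← sub_div, abs_div, abs_of_pos hm]
  gcongr
  have h2 : ((e (τ ω) i j : ℕ) : ℝ) ≤ e (τ ω) i' j + n := mod_cast (hspec ω).1.2 i i' j
  have h3 : ((e (τ ω) i' j : ℕ) : ℝ) ≤ e (τ ω) i j + n := mod_cast (hspec ω).1.2 i' i j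
  exact abs_le.2 ⟨by linarith, by linarith⟩

/-- **Random Brouwer fixed point theorem** for `L⁰`-simplexes. -/
theorem SigmaStableMap.exists_fixedPoint [IsProbabilityMeasure P] [NeZero n]
    (hx : AffineIndependentL0 P 𝕂 x) (hs : SigmaStableMap P 𝕂 f)
    (hf : RandomSeqContinuous P 𝕂 f) : ∃ z, f z = z := by
  choose G H hGH hle hdist using fun m => hs.exists_approx m
  -- Extracting a limit for the index `0` suffices, since the points `G m i` approach each other as
  -- `m` grows.
  obtain ⟨ν, y, hν, hνk, hy, hyl⟩ := exists_random_subsequence_tendsto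
    (fun m => (G m 0).measurable_coord) (fun m ω i => (G m 0).abs_coord_le_one ω i)
  set Y : RandomPoint Ω n := ⟨y, hy, fun ω => (isClosed_stdSimplex ℝ (Fin n)).mem_of_tendsto (hyl ω)
    (Eventually.of_forall fun k => (G (ν k ω) 0).coord_mem ω)⟩ with hY
  obtain ⟨z, hz⟩ := exists_comb_eq P 𝕂 (f (simplexPoint P 𝕂 x Y)).2
  have hYz : f (simplexPoint P 𝕂 x Y) = simplexPoint P 𝕂 x z := Subtype.ext hz.symm
  have hzero : ∀ ω, Tendsto (fun k => (n : ℝ) / ((ν k ω : ℝ) + 1)) atTop (nhds 0) := fun ω => by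
    have h1 := (tendsto_one_div_add_atTop_nhds_zero_nat (𝕜 := ℝ)).const_mul (n : ℝ)
    simp only [mul_one_div, mul_zero] at h1
    exact h1.comp (tendsto_atTop_mono (fun k => hνk k ω) tendsto_id)
  have hconv : ∀ i ω, Tendsto (fun k => (G (ν k ω) i).coord ω) atTop (nhds (y ω)) := fun i ω => by
    refine tendsto_pi_nhds.2 fun j => ?_
    have h1 : Tendsto (fun k => (G (ν k ω) i).coord ω j - (G (ν k ω) 0).coord ω j) atTop (nhds 0) :=
      squeeze_zero_norm (fun k => hdist _ ω i 0 j) (hzero ω)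
    simpa using h1.add (tendsto_pi_nhds.1 (hyl ω) j)
  -- The approximate inequality for `G m i` passes to the limit; the subsequence may depend on `i`
  -- and ω, since only the limits are compared.
  have key : ∀ i, ∀ᵐ ω ∂P, y ω i ≤ z.coord ω i := fun i => by
    filter_upwards [hf.ae_exists_tendsto_coord hx hs
      (fun k => hs.apply_simplexPoint_select (fun m => hGH m i) (hν k)) hYz (hconv i)] with ω h1
    obtain ⟨s, hs1, hs2⟩ := h1
    have h2 := (tendsto_pi_nhds.1 ((hconv i ω).comp hs1) i).sub ((hzero ω).comp hs1)
    rw [sub_zero] at h2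
    exact le_of_tendsto_of_tendsto' h2 (tendsto_pi_nhds.1 hs2 i) fun k => hle _ ω i
  refine ⟨simplexPoint P 𝕂 x Y, hYz.trans (Subtype.ext (comb_congr_ae x ?_))⟩
  filter_upwards [ae_all_iff.2 key] with ω hω
  funext i
  have h1 := (Finset.sum_eq_sum_iff_of_le fun i _ => hω i).1
    ((Y.coord_mem ω).2.trans (z.coord_mem ω).2.symm)
  exact (h1 i (Finset.mem_univ i)).symm

end FixedPoint

end RandomBrouwer

end

theorem mainTheorem4 {Ω : Type*} [MeasurableSpace Ω] (P : MeasureTheory.Measure Ω)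
    [MeasureTheory.IsProbabilityMeasure P] (𝕂 : Type*) [RCLike 𝕂]
    (E : Type*) [AddCommGroup E] [Module (Ω →ₘ[P] 𝕂) E] [RandomBrouwer.RNModule P 𝕂 E]
    (n : ℕ) [NeZero n] (x : Fin n → E)
    (hx : RandomBrouwer.AffineIndependentL0 P 𝕂 x)
    (f : RandomBrouwer.convL0 P 𝕂 (Set.range x) → RandomBrouwer.convL0 P 𝕂 (Set.range x))
    (hf_stable : RandomBrouwer.SigmaStableMap P 𝕂 f)
    (hf_cont : RandomBrouwer.RandomSeqContinuous P 𝕂 f) :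
    ∃ z : RandomBrouwer.convL0 P 𝕂 (Set.range x), f z = z :=
  RandomBrouwer.SigmaStableMap.exists_fixedPoint hx hf_stable hf_cont
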